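/- **Theorem (CCZ is transversal in stacked 3D surface codes).** Let $d\ge 2$ and $L=2d-2$. *The lattice.* The rectified cubic lattice has as vertices the points $(x,y,z)\in\mathbb Z^3$ with either $x,y,z$ all even, or $z$ and $x+y$ both odd. Its cells are octahedra ($g$-cells), centred at the points (even, even, odd) and having the 6 lattice vertices at distance $1$ from the centre, and cuboctahedra, centred at the points (odd, odd, even) and having the 12 lattice vertices at distance $\sqrt2$ from the centre; a cuboctahedron with centre $(x,y,z)$ is an $r$-cell if $x+y+z\equiv 2 \pmod 4$ and a $b$-cell if $x+y+z\equiv 0\pmod 4$. The common face of two adjacent cells of colours $c\neq c'$ is a $cc'$-face. The distance-$d$ lattice is the part in the cube $[0,L]^3$; let $V$ be its set of vertices. Its cells are the cells with centre in $[0,L]^3$, restricted to $V$. Its $r$-boundaries are $x=0$ and $x=L$, its $b$-boundaries are $y=0$ and $y=L$, and its $g$-boundaries are $z=0$ and $z=L$. *The codes.* At every vertex of $V$ there are three qubits, one for each of the codes $\mathcal{SC}_r,\mathcal{SC}_g,\mathcal{SC}_b$. - The code $\mathcal{SC}_c$ has an $X$ stabilizer on the vertices of each $c$-cell. In addition, $\mathcal{SC}_r$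 has an $X$ stabilizer on each face of a $b$-cuboctahedron that lies on a $b$-boundary (a 2D flattening of an $r$-cell), and $\mathcal{SC}_b$ has an $X$ stabilizer on each face of an $r$-cuboctahedron that lies on an $r$-boundary (a 2D flattening of a $b$-cell). - The code $\mathcal{SC}_g$ has a $Z$ stabilizer on each $rb$-face (all square faces of cuboctahedra of the distance-$d$ lattice, restricted to $V$, including those on the boundaries). - The code $\mathcal{SC}_b$ has a $Z$ stabilizer on each $rg$-face (common face of an $r$-cell and a $g$-cell of the distance-$d$ lattice), and a weight-two $Z$ stabilizer on each edge that is the common part of a 2D flattening of an $r$-cell and a $g$-cell of the distance-$d$ lattice adjacent to the $r$-cell that was flattened. The code $\mathcal{SC}_r$ has $Z$ stabilizers described in the same way with $r$ and $b$ exchanged. *The encoded states.* For each colour $c$ choose one of the two $c$-boundaries, and let $X^c\in\mathbb F_2^V$ be the indicator vector of the vertices on it (the support of the canonical logical operator $\overline X_c$). Let $G_0^c\subseteq\mathbb F_2^V$ be the span of the indicator vectors of the supports of the $X$ stabilizers of $\mathcal{SC}_c$, and $G_1^c=X^c+G_0^c$. Put $$|\overline{\alpha}\rangle_c=\frac1{\sqrt{|G^c_\alpha|}}\sum_{x\in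 G^c_\alpha}|x\rangle_c\quad(\alpha\in\{0,1\}),\qquad |\overline{\alpha\beta\gamma}\rangle=|\overline\alpha\rangle_r|\overline\beta\rangle_g|\overline\gamma\rangle_b .$$ Then, for every choice of the three boundaries: 1. the eight states $|\overline{\alpha\beta\gamma}\rangle$ form an orthonormal basis of the code space of the stack, that is, of the joint $+1$ eigenspace of all the $X$ and $Z$ stabilizers of the three codes (so that the stack encodes three logical qubits); 2. the gate $CCZ^{\otimes V}$, which applies $CCZ$ to the three qubits at every vertex, implements the logical $CCZ$ on them: $CCZ^{\otimes V}|\overline{\alpha\beta\gamma}\rangle=-|\overline{\alpha\beta\gamma}\rangle$ if $\alpha=\beta=\gamma=1$, and $CCZ^{\otimes V}|\overline{\alpha\beta\gamma}\rangle=|\overline{\alpha\beta\gamma}\rangle$ otherwise; 3. for all $\alpha,\beta,\gamma\in\{0,1\}$ and all $t\in G^r_\alpha$, $u\in G^g_\beta$, $v\in G^b_\gamma$, the number of vertices at which $t$, $u$ and $v$ are all equal to $1$ is odd if and only if $\alpha=\beta=\gamma=1$. -/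

import Mathlib

namespace CCZStack

/-- The three colours: they label the cells, the boundaries and the three surface codes. -/
inductive Colour where
  | r
  | g
  | b
  deriving DecidableEq

instance : Fintype Colour where
  elems := {Colour.r, Colour.g, Colour.b}
  complete := by intro c; cases c <;> simp

/-- Points of the integer grid, on which the (infinite) rectified cubic lattice is drawn. -/
abbrev Point : Type := ℤ × ℤ × ℤ

/-- Squared Euclidean distance. -/
def sqDist (p q : Point) : ℤ :=
  (p.1 - q.1) ^ 2 + (p.2.1 - q.2.1) ^ 2 + (p.2.2 - q.2.2) ^ 2

/-! ### The infinite rectified cubic lattice -/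

/-- The vertices of the infinite rectified cubic lattice, layer by layer: the planes with `z` even
are the chequerboard layers and the planes with `z` odd are the diamond layers. -/
def IsSite (p : Point) : Prop :=
  (Even p.2.2 ∧ Even p.1 ∧ Even p.2.1) ∨ (Odd p.2.2 ∧ Odd (p.1 + p.2.1))

instance (p : Point) : Decidable (IsSite p) := by unfold IsSite; infer_instance

/-- `IsCentre c p`: the point `p` is the centre of a cell of colour `c` of the infinite lattice.
The octahedra (`g`) are centred at the points (even, even, odd), the cuboctahedra at the points
(odd, odd, even); cuboctahedra that share a (square) face have different colours `r`, `b`. -/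
def IsCentre : Colour → Point → Prop
  | .g, p => Even p.1 ∧ Even p.2.1 ∧ Odd p.2.2
  | .r, p => Odd p.1 ∧ Odd p.2.1 ∧ Even p.2.2 ∧ (p.1 + p.2.1 + p.2.2) % 4 = 2
  | .b, p => Odd p.1 ∧ Odd p.2.1 ∧ Even p.2.2 ∧ (p.1 + p.2.1 + p.2.2) % 4 = 0

/-- Squared circumradius of a cell: the vertices of a cell are the lattice vertices at this squared
distance from its centre (6 vertices for an octahedron, 12 for a cuboctahedron). -/
def sqRadius : Colour → ℤ
  | .g => 1
  | .r => 2
  | .b => 2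

/-! ### The distance-`d` lattice -/

/-- The side length of the cube occupied by the distance-`d` lattice: `d` chequerboard layers
(`z = 0, 2, …, 2d - 2`) and `d - 1` diamond layers (`z = 1, 3, …, 2d - 3`). -/
def side (d : ℕ) : ℤ := 2 * (d : ℤ) - 2

/-- The point lies in the cube `[0, side d]³`. -/
def InBox (d : ℕ) (p : Point) : Prop :=
  (0 ≤ p.1 ∧ p.1 ≤ side d) ∧ (0 ≤ p.2.1 ∧ p.2.1 ≤ side d) ∧ (0 ≤ p.2.2 ∧ p.2.2 ≤ side d)

/-- The vertices of the distance-`d` rectified cubic lattice. -/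
noncomputable def siteFinset (d : ℕ) : Finset Point :=
  (Finset.Icc 0 (side d) ×ˢ Finset.Icc 0 (side d) ×ˢ Finset.Icc 0 (side d)).filter IsSite

/-- The vertices of the distance-`d` rectified cubic lattice, as a type. -/
abbrev Vertex (d : ℕ) : Type := {p : Point // p ∈ siteFinset d}

/-- The coordinate along which the two `c`-boundaries are opposite: the `r`-boundaries are left and
right, the `b`-boundaries front and back, the `g`-boundaries bottom and top. -/
def axis : Colour → Point → ℤ
  | .r, p => p.1
  | .b, p => p.2.1
  | .g, p => p.2.2

/-- The vertices on one of the two `c`-boundaries (`s` says which of the two). -/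
def boundary (d : ℕ) (c : Colour) (s : Bool) : Set (Vertex d) :=
  {v | axis c v.1 = if s then side d else 0}

/-- The vertices of the distance-`d` lattice that belong to the cell of colour `c` centred at `p`
(so cells that the boundary cuts are incomplete). -/
def cellSupport (d : ℕ) (c : Colour) (p : Point) : Set (Vertex d) :=
  {v | sqDist v.1 p = sqRadius c}

/-- Centres of the extra boundary cells. On the `b`-boundaries (`y = 0` and `y = side d`) the faces
of the `b`-cuboctahedra are turned into 2D flattenings of `r`-cells: such a face is what the lattice
keeps of the `r`-cuboctahedron centred at distance one beyond the boundary. The same holds on the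
`r`-boundaries with `r` and `b` exchanged. -/
def IsFlattened (d : ℕ) : Colour → Point → Prop
  | .g, _ => False
  | .r, p => (0 ≤ p.1 ∧ p.1 ≤ side d) ∧ (0 ≤ p.2.2 ∧ p.2.2 ≤ side d) ∧
      (p.2.1 = -1 ∨ p.2.1 = side d + 1)
  | .b, p => (0 ≤ p.2.1 ∧ p.2.1 ≤ side d) ∧ (0 ≤ p.2.2 ∧ p.2.2 ≤ side d) ∧
      (p.1 = -1 ∨ p.1 = side d + 1)

/-- `p` is the centre of a `c`-cell of the distance-`d` lattice, 2D flattenings included. -/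
def IsCell (d : ℕ) (c : Colour) (p : Point) : Prop :=
  IsCentre c p ∧ (InBox d p ∨ IsFlattened d c p)

/-- Supports of the `X` stabilizer generators of the code `c`: the `c`-cells. -/
def xSupports (d : ℕ) (c : Colour) : Set (Set (Vertex d)) :=
  {S | ∃ p, IsCell d c p ∧ S = cellSupport d c p}

/-- Supports of the `Z` stabilizer generators of the code `c`: the faces of the two other colours.
A face is what the lattice keeps of the common face of two adjacent cells of the infinite lattice
(centres at squared distance 4 for two cuboctahedra, 3 for a cuboctahedron and an octahedron).
* `rb`-faces: all square faces of the cuboctahedra of the lattice, including those on the boundary,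
  which keep the colour that they have in the infinite lattice;
* `rg`-faces: the common faces of an `r`-cell and a `g`-cell. If the `r`-cell is a 2D flattening,
  this is an edge on a `b`-boundary (a weight-two stabilizer);
* `gb`-faces: the same with `r` and `b` exchanged. -/
def zSupports (d : ℕ) : Colour → Set (Set (Vertex d))
  | .g => {S | S.Nonempty ∧ ∃ p q, IsCentre .r p ∧ IsCentre .b q ∧ (InBox d p ∨ InBox d q) ∧
      sqDist p q = 4 ∧ S = cellSupport d .r p ∩ cellSupport d .b q}
  | .b => {S | ∃ p q, IsCell d .r p ∧ IsCell d .g q ∧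
      sqDist p q = 3 ∧ S = cellSupport d .r p ∩ cellSupport d .g q}
  | .r => {S | ∃ p q, IsCell d .b p ∧ IsCell d .g q ∧
      sqDist p q = 3 ∧ S = cellSupport d .b p ∩ cellSupport d .g q}

/-! ### Qubits and operators -/

/-- Tensor product of the operators `M i` (each on a copy of the space with basis `κ`). -/
def tensorOp {ι κ : Type} [Fintype ι] (M : ι → Matrix κ κ ℂ) : Matrix (ι → κ) (ι → κ) ℂ :=
  Matrix.of fun x y => ∏ i, M i (x i) (y i)

/-- The Pauli matrix `X` on one qubit. -/
def pauliX : Matrix (ZMod 2) (ZMod 2) ℂ := Matrix.of fun i j => if i = j then 0 else 1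

/-- The Pauli matrix `Z` on one qubit. -/
def pauliZ : Matrix (ZMod 2) (ZMod 2) ℂ := Matrix.diagonal fun i => if i = 0 then 1 else -1

/-- The gate `CCZ` on three qubits (one per colour). -/
def ccz : Matrix (Colour → ZMod 2) (Colour → ZMod 2) ℂ :=
  Matrix.diagonal fun a => if ∀ c, a c = 1 then -1 else 1

/-- Labels of the computational basis of the stack: three qubits (one per code) at each vertex. -/
abbrev Config (d : ℕ) : Type := Vertex d → Colour → ZMod 2

/-- The state space of all the physical qubits of the stack. -/
abbrev StackSpace (d : ℕ) : Type := EuclideanSpace ℂ (Config d)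

/-- The state space of the physical qubits of one code (one qubit per vertex). -/
abbrev PhysSpace (d : ℕ) : Type := EuclideanSpace ℂ (Vertex d → ZMod 2)

open Classical in
/-- The operator that applies `P` to the qubits of the code `c` at the vertices in `S`, and the
identity to all the other qubits. -/
noncomputable def applyOn (d : ℕ) (P : Matrix (ZMod 2) (ZMod 2) ℂ) (c : Colour)
    (S : Set (Vertex d)) : StackSpace d →ₗ[ℂ] StackSpace d :=
  Matrix.toEuclideanLin
    (tensorOp fun v : Vertex d => tensorOp fun c' : Colour => if c' = c ∧ v ∈ S then P else 1)

/-- The physical gate: a `CCZ` on the three qubits at every vertex. -/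
noncomputable def transversalCCZ (d : ℕ) : StackSpace d →ₗ[ℂ] StackSpace d :=
  Matrix.toEuclideanLin (tensorOp fun _ : Vertex d => ccz)

/-- The code space of the stack: the joint `+1` eigenspace of all the `X` and `Z` stabilizers of the
three codes. -/
noncomputable def codeSpace (d : ℕ) : Submodule ℂ (StackSpace d) :=
  ⨅ c : Colour,
    (⨅ S ∈ xSupports d c, Module.End.eigenspace (applyOn d pauliX c S) 1) ⊓
    (⨅ S ∈ zSupports d c, Module.End.eigenspace (applyOn d pauliZ c S) 1)

/-! ### Encoded states -/

/-- The binary vector of a set of vertices. -/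
noncomputable def binVec (d : ℕ) (S : Set (Vertex d)) : Vertex d → ZMod 2 := S.indicator 1

/-- The span `G₀` of the binary vectors of the `X` stabilizer generators of the code `c`. -/
noncomputable def xSpan (d : ℕ) (c : Colour) : Submodule (ZMod 2) (Vertex d → ZMod 2) :=
  Submodule.span (ZMod 2) (binVec d '' xSupports d c)

/-- The coset `G_a = a X + G₀`, where `X` is the binary vector of the canonical logical operator `X`
of the code `c`, which acts on all the vertices of one of the `c`-boundaries (the one given by
`s c`). -/
def xCoset (d : ℕ) (s : Colour → Bool) (c : Colour) (a : ZMod 2) : Set (Vertex d → ZMod 2) :=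
  {x | ∃ h ∈ xSpan d c, x = a • binVec d (boundary d c (s c)) + h}

open Classical in
/-- The encoded basis state of the code `c`: the normalized uniform superposition of the elements
of `G_a`. -/
noncomputable def encodedKet (d : ℕ) (s : Colour → Bool) (c : Colour) (a : ZMod 2) :
    PhysSpace d :=
  ((1 / Real.sqrt (Nat.card (xCoset d s c a)) : ℝ) : ℂ) •
    ∑ x : Vertex d → ZMod 2 with x ∈ xCoset d s c a, EuclideanSpace.single x (1 : ℂ)

/-- The encoded basis state of the stack: the tensor product of the encoded basis states
of the three codes. -/
noncomputable def stackKet (d : ℕ) (s : Colour → Bool) (a : Colour → ZMod 2) : StackSpace d :=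
  WithLp.toLp 2 fun x : Config d => ∏ c, encodedKet d s c (a c) fun v => x v c

/-- The number of lattice collisions of three binary vectors (one per code): the number of vertices
at which all three are equal to one. -/
noncomputable def collisions (d : ℕ) (x : Colour → Vertex d → ZMod 2) : ℕ :=
  (Finset.univ.filter fun v : Vertex d => ∀ c, x c v = 1).card

end CCZStack

/-!
Modulo two, the number of vertices at which `t`, `u` and `v` are all `1` is a trilinear form. If
each of `t`, `u`, `v` is the support of an `X` stabilizer or a chosen boundary, and at least one
of them is a stabilizer, then the three supports meet in an even number of vertices, because a
reflection acts on the intersection without fixed points; three boundaries meet in exactly one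
corner. On the cosets `G^r_α`, `G^g_β`, `G^b_γ` the form is therefore constant, equal to `αβγ`.
Since `CCZ^{⊗V}` is diagonal with the parity of this number as sign, it acts as the logical `CCZ`.
The same reflections make the `X` stabilizers and the logical operators commute with the `Z`
stabilizers.

Conversely, a vector orthogonal to all `Z` stabilizers of the code `c` lies in `G^c_0` or `G^c_1`.
It can be cleaned layer by layer along the axis `c`, from `0` to `L`. On an odd layer it vanishes
as soon as it vanishes below, since every vertex there is the unique highest one of some `Z`
stabilizer. On an even layer below `L` every vertex lies on one cell of colour `c` centred in the
next layer, and `Z` stabilizers force the vector to be constant on the part of the cell in the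
layer, so adding cells clears the layer. On the last layer the vector is constant: a multiple of
the boundary.

A vector in the code space is invariant under translation by each `G^c_0` and vanishes off the
configurations orthogonal to the `Z` stabilizers; it is thus constant on each product of three
cosets and zero elsewhere, that is, a combination of the eight encoded states.
-/

namespace CCZStack

variable {d : ℕ}

theorem mem_siteFinset {p : Point} : p ∈ siteFinset d ↔ InBox d p ∧ IsSite p := by
  simp [siteFinset, InBox]

theorem natAbs_le_one_of_sq_add_sq_add_sq_le_two {x y z : ℤ} (h : x ^ 2 + y ^ 2 + z ^ 2 ≤ 2) :
    x.natAbs ≤ 1 := by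
  by_contra! hx
  have : 2 ^ 2 ≤ x ^ 2 := Int.natAbs_le_iff_sq_le.1 hx
  nlinarith [sq_nonneg y, sq_nonneg z]

theorem mem_cellSupport {c : Colour} {p : Point} (hp : IsCentre c p) {v : Vertex d} :
    v ∈ cellSupport d c p ↔ (p.1 - 1 ≤ v.1.1 ∧ v.1.1 ≤ p.1 + 1) ∧
      (p.2.1 - 1 ≤ v.1.2.1 ∧ v.1.2.1 ≤ p.2.1 + 1) ∧
      (p.2.2 - 1 ≤ v.1.2.2 ∧ v.1.2.2 ≤ p.2.2 + 1) := by
  obtain ⟨⟨x, y, z⟩, hv⟩ := v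
  obtain ⟨p₁, p₂, p₃⟩ := p
  have hv := (mem_siteFinset.1 hv).2
  simp only [cellSupport, Set.mem_ofPred_eq, sqDist]
  constructor
  · intro h
    have hc : sqRadius c ≤ 2 := by cases c <;> decide
    have hx := natAbs_le_one_of_sq_add_sq_add_sq_le_two (h.trans_le hc)
    have hy := natAbs_le_one_of_sq_add_sq_add_sq_le_two
      (x := y - p₂) (y := x - p₁) (z := z - p₃) (by linarith)
    have hz := natAbs_le_one_of_sq_add_sq_add_sq_le_two
      (x := z - p₃) (y := x - p₁) (z := y - p₂) (by linarith)
    omega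
  · rintro ⟨hx, hy, hz⟩
    have hx : x - p₁ = 0 ∨ x - p₁ = 1 ∨ x - p₁ = -1 := by omega
    have hy : y - p₂ = 0 ∨ y - p₂ = 1 ∨ y - p₂ = -1 := by omega
    have hz : z - p₃ = 0 ∨ z - p₃ = 1 ∨ z - p₃ = -1 := by omega
    simp only [IsSite, Int.even_iff, Int.odd_iff] at hv
    cases c <;> simp only [IsCentre, Int.even_iff, Int.odd_iff] at hp <;>
    rcases hx with hx | hx | hx <;> rcases hy with hy | hy | hy <;> rcases hz with hz | hz | hz <;>
      first | (rw [hx, hy, hz]; rfl) | omega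

theorem sum_binVec_eq_zero_of_involutive {S : Set (Vertex d)} {σ : Point → Point}
    (hσ : σ.Involutive) (hS : ∀ v ∈ S, ∃ w ∈ S, w.1 = σ v.1 ∧ w ≠ v) : ∑ v, binVec d S v = 0 := by
  classical
  choose! τ hτS hτ hne using hS
  simp only [binVec, Set.indicator_apply, ← Finset.sum_filter]
  refine Finset.sum_involution (fun v _ => τ v) (fun v _ => CharTwo.add_self_eq_zero (1 : ZMod 2))
    (fun v hv _ => hne v (by simpa using hv)) (fun v hv => by simpa using hτS v (by simpa using hv))
    fun v hv => Subtype.ext ?_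
  have hv : v ∈ S := by simpa using hv
  rw [hτ _ (hτS v hv), hτ v hv, hσ]

theorem isSite_iff {p : Point} : IsSite p ↔ (p.1 + p.2.1 + p.2.2) % 2 = 0 ∧
    ¬ (p.1 % 2 = 1 ∧ p.2.1 % 2 = 1 ∧ p.2.2 % 2 = 0) := by
  simp only [IsSite, Int.even_iff, Int.odd_iff]
  omega

theorem exists_reflected_coord {p q o v : ℤ} (hpq : p % 2 = q % 2) (hpo : p % 2 ≠ o % 2)
    (hvp : p - 1 ≤ v ∧ v ≤ p + 1) (hvo : o - 1 ≤ v ∧ v ≤ o + 1) (hvq : q - 1 ≤ v ∧ v ≤ q + 1) :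
    ∃ w, w = (p + q) / 2 + o - v ∧ (w = o ∨ v = o) ∧
      (p - 1 ≤ w ∧ w ≤ p + 1) ∧ (o - 1 ≤ w ∧ w ≤ o + 1) ∧ (q - 1 ≤ w ∧ w ≤ q + 1) ∧
      ∀ L, 0 ≤ v ∧ v ≤ L → 0 ≤ o ∧ o ≤ L → (0 ≤ p ∧ p ≤ L ∨ 0 ≤ q ∧ q ≤ L) → 0 ≤ w ∧ w ≤ L :=
  ⟨_, rfl, by omega, by omega, by omega, by omega, fun L _ _ _ => by omega⟩

theorem isSite_and_ne_of_swap {o v w : Point} (ho : IsCentre .g o) (hv : IsSite v)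
    (hw : (w.1 + w.2.1 + w.2.2) % 2 = 0) (h₁ : w.1 = o.1 ∨ v.1 = o.1)
    (h₂ : w.2.1 = o.2.1 ∨ v.2.1 = o.2.1) (h₃ : w.2.2 = o.2.2 ∨ v.2.2 = o.2.2) :
    IsSite w ∧ w ≠ v := by
  rw [isSite_iff] at hv ⊢
  simp only [IsCentre, Int.even_iff, Int.odd_iff] at ho
  refine ⟨by omega, ?_⟩
  rintro rfl
  omega

theorem sum_binVec_cells_eq_zero {p o q : Point} (hp : IsCentre .r p) (ho : IsCentre .g o)
    (hq : IsCentre .b q) (hoB : InBox d o)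
    (hpq : (cellSupport d .r p ∩ cellSupport d .b q).Nonempty → InBox d p ∨ InBox d q) :
    ∑ v, binVec d (cellSupport d .r p ∩ cellSupport d .g o ∩ cellSupport d .b q) v = 0 := by
  -- `σ` is the reflection in the midpoint of the common edge of the three cells, which is halfway
  -- between `o` and the centre `(p + q) / 2` of the common face of the cuboctahedra.
  let σ : Point → Point := fun v => ((p.1 + q.1) / 2 + o.1 - v.1,
    (p.2.1 + q.2.1) / 2 + o.2.1 - v.2.1, (p.2.2 + q.2.2) / 2 + o.2.2 - v.2.2)
  refine sum_binVec_eq_zero_of_involutive (σ := σ) (fun v => by simp [σ]) ?_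
  rintro v ⟨⟨hvp, hvo⟩, hvq⟩
  replace hpq := hpq ⟨v, hvp, hvq⟩
  simp only [mem_cellSupport, hp, ho, hq] at hvp hvo hvq
  obtain ⟨hvB, hvS⟩ := mem_siteFinset.1 v.2
  have hpar := And.intro hp (And.intro ho hq)
  simp only [IsCentre, Int.even_iff, Int.odd_iff] at hpar
  obtain ⟨hp', ho', hq'⟩ := hpar
  obtain ⟨x, hx, hxo, hxp, hxo', hxq, hxB⟩ := exists_reflected_coord
    (hp'.1.trans hq'.1.symm) (by simp [hp', ho']) hvp.1 hvo.1 hvq.1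
  obtain ⟨y, hy, hyo, hyp, hyo', hyq, hyB⟩ := exists_reflected_coord
    (hp'.2.1.trans hq'.2.1.symm) (by simp [hp', ho']) hvp.2.1 hvo.2.1 hvq.2.1
  obtain ⟨z, hz, hzo, hzp, hzo', hzq, hzB⟩ := exists_reflected_coord
    (hp'.2.2.1.trans hq'.2.2.1.symm) (by simp [hp', ho']) hvp.2.2 hvo.2.2 hvq.2.2
  have hσ : (x, y, z) = σ v.1 := by rw [hx, hy, hz]
  have hsum : (x + y + z) % 2 = 0 := by
    have := (isSite_iff.1 hvS).1
    rw [hx, hy, hz]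
    clear *- hp' hq' ho' this
    omega
  obtain ⟨hS, hne⟩ := isSite_and_ne_of_swap (w := (x, y, z)) ho hvS hsum hxo hyo hzo
  exact ⟨⟨(x, y, z), mem_siteFinset.2 ⟨⟨hxB _ hvB.1 hoB.1 (hpq.imp (·.1) (·.1)),
      hyB _ hvB.2.1 hoB.2.1 (hpq.imp (·.2.1) (·.2.1)),
      hzB _ hvB.2.2 hoB.2.2 (hpq.imp (·.2.2) (·.2.2))⟩, hS⟩⟩,
    ⟨⟨(mem_cellSupport hp).2 ⟨hxp, hyp, hzp⟩, (mem_cellSupport ho).2 ⟨hxo', hyo', hzo'⟩⟩,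
      (mem_cellSupport hq).2 ⟨hxq, hyq, hzq⟩⟩, hσ, Subtype.coe_ne_coe.1 hne⟩

theorem mem_boundary {c : Colour} {s : Bool} {v : Vertex d} :
    v ∈ boundary d c s ↔ axis c v.1 = if s then side d else 0 :=
  Iff.rfl

theorem mem_boundary_emod_two {c : Colour} {s : Bool} {v : Vertex d} (hv : v ∈ boundary d c s) :
    axis c v.1 % 2 = 0 := by
  simp only [mem_boundary, side] at hv
  split_ifs at hv <;> omega

theorem sum_binVec_cells_boundary_g {p q : Point} (hp : IsCentre .r p) (hq : IsCentre .b q)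
    (hpq : (cellSupport d .r p ∩ cellSupport d .b q).Nonempty → InBox d p ∨ InBox d q)
    (s : Bool) :
    ∑ v, binVec d (cellSupport d .r p ∩ boundary d .g s ∩ cellSupport d .b q) v = 0 := by
  let σ : Point → Point := fun v => (p.1 + q.1 - v.1, p.2.1 + q.2.1 - v.2.1, v.2.2)
  refine sum_binVec_eq_zero_of_involutive (σ := σ) (fun v => by simp [σ]) ?_
  rintro v ⟨⟨hvp, hvs⟩, hvq⟩
  replace hpq := hpq ⟨v, hvp, hvq⟩
  obtain ⟨hvB, hvS⟩ := mem_siteFinset.1 v.2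
  simp only [mem_cellSupport, hp, hq] at hvp hvq
  have hz : v.1.2.2 % 2 = 0 := mem_boundary_emod_two hvs
  have hw : InBox d (σ v.1) ∧ IsSite (σ v.1) ∧ σ v.1 ≠ v.1 := by
    simp only [IsCentre, Int.even_iff, Int.odd_iff] at hp hq
    simp only [isSite_iff] at hvS ⊢
    simp only [InBox, side] at hvB hpq ⊢
    rw [ne_eq, Prod.ext_iff, Prod.ext_iff]
    dsimp only [σ]
    omega
  refine ⟨⟨σ v.1, mem_siteFinset.2 ⟨hw.1, hw.2.1⟩⟩, ⟨⟨?_, hvs⟩, ?_⟩, rfl,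
    Subtype.coe_ne_coe.1 hw.2.2⟩
  · rw [mem_cellSupport hp]
    dsimp only [σ]
    omega
  · rw [mem_cellSupport hq]
    dsimp only [σ]
    omega

theorem sum_binVec_cells_boundary_r {p o : Point} (hp : IsCell d .b p) (ho : IsCell d .g o)
    (s : Bool) :
    ∑ v, binVec d (boundary d .r s ∩ cellSupport d .g o ∩ cellSupport d .b p) v = 0 := by
  let σ : Point → Point := fun v => (v.1, p.2.1 + o.2.1 - v.2.1, p.2.2 + o.2.2 - v.2.2)
  refine sum_binVec_eq_zero_of_involutive (σ := σ) (fun v => by simp [σ]) ?_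
  rintro v ⟨⟨hvs, hvo⟩, hvp⟩
  obtain ⟨hvB, hvS⟩ := mem_siteFinset.1 v.2
  simp only [mem_cellSupport, hp.1, ho.1] at hvp hvo
  have hx : v.1.1 % 2 = 0 := mem_boundary_emod_two hvs
  have hw : InBox d (σ v.1) ∧ IsSite (σ v.1) ∧ σ v.1 ≠ v.1 := by
    simp only [IsCell, IsCentre, IsFlattened, or_false, Int.even_iff, Int.odd_iff] at hp ho
    simp only [isSite_iff] at hvS ⊢
    simp only [InBox, side] at hvB hp ho ⊢
    rw [ne_eq, Prod.ext_iff, Prod.ext_iff]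
    dsimp only [σ]
    refine ⟨?_, ?_, ?_⟩ <;> omega
  refine ⟨⟨σ v.1, mem_siteFinset.2 ⟨hw.1, hw.2.1⟩⟩, ⟨⟨hvs, ?_⟩, ?_⟩, rfl,
    Subtype.coe_ne_coe.1 hw.2.2⟩
  · rw [mem_cellSupport ho.1]
    dsimp only [σ]
    omega
  · rw [mem_cellSupport hp.1]
    dsimp only [σ]
    omega

theorem sum_binVec_cells_boundary_b {p o : Point} (hp : IsCell d .r p) (ho : IsCell d .g o)
    (s : Bool) :
    ∑ v, binVec d (cellSupport d .r p ∩ cellSupport d .g o ∩ boundary d .b s) v = 0 := by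
  let σ : Point → Point := fun v => (p.1 + o.1 - v.1, v.2.1, p.2.2 + o.2.2 - v.2.2)
  refine sum_binVec_eq_zero_of_involutive (σ := σ) (fun v => by simp [σ]) ?_
  rintro v ⟨⟨hvp, hvo⟩, hvs⟩
  obtain ⟨hvB, hvS⟩ := mem_siteFinset.1 v.2
  simp only [mem_cellSupport, hp.1, ho.1] at hvp hvo
  have hy : v.1.2.1 % 2 = 0 := mem_boundary_emod_two hvs
  have hw : InBox d (σ v.1) ∧ IsSite (σ v.1) ∧ σ v.1 ≠ v.1 := by
    simp only [IsCell, IsCentre, IsFlattened, or_false, Int.even_iff, Int.odd_iff] at hp ho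
    simp only [isSite_iff] at hvS ⊢
    simp only [InBox, side] at hvB hp ho ⊢
    rw [ne_eq, Prod.ext_iff, Prod.ext_iff]
    dsimp only [σ]
    refine ⟨?_, ?_, ?_⟩ <;> omega
  refine ⟨⟨σ v.1, mem_siteFinset.2 ⟨hw.1, hw.2.1⟩⟩, ⟨⟨?_, ?_⟩, hvs⟩, rfl,
    Subtype.coe_ne_coe.1 hw.2.2⟩
  · rw [mem_cellSupport hp.1]
    dsimp only [σ]
    omega
  · rw [mem_cellSupport ho.1]
    dsimp only [σ]
    omega

theorem inBox_or_inBox {p q : Point} (hp : IsCell d .r p) (hq : IsCell d .b q)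
    (hpq : (cellSupport d .r p ∩ cellSupport d .b q).Nonempty) : InBox d p ∨ InBox d q := by
  obtain ⟨v, hvp, hvq⟩ := hpq
  simp only [mem_cellSupport, hp.1, hq.1] at hvp hvq
  refine or_iff_not_imp_left.2 fun hpB => by_contra fun hqB => ?_
  have hpF := hp.2.resolve_left hpB
  have hqF := hq.2.resolve_left hqB
  obtain ⟨hvB, hvS⟩ := mem_siteFinset.1 v.2
  replace hp := hp.1
  replace hq := hq.1
  rw [isSite_iff] at hvS
  simp only [IsCentre, IsFlattened, InBox, side, Int.even_iff, Int.odd_iff] at hp hq hpF hqF hvB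
  clear hpB hqB
  have hx : p.1 - q.1 = 2 ∨ p.1 - q.1 = -2 := by omega
  have hy : p.2.1 - q.2.1 = 2 ∨ p.2.1 - q.2.1 = -2 := by omega
  have hxe : v.1.1 % 2 = 0 := by omega
  have hye : v.1.2.1 % 2 = 0 := by omega
  omega

theorem sum_binVec_cell_boundaries {s : Colour → Bool} {X : Colour → Set (Vertex d)} {c : Colour}
    {p : Point} (hp : IsCell d c p) (hc : X c = cellSupport d c p)
    (hX : ∀ c' ≠ c, X c' = boundary d c' (s c')) : ∑ v, binVec d (⋂ c, X c) v = 0 := by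
  let σ : Point → Point := fun v => match (generalizing := false) c with
    | .r => (2 * p.1 - v.1, v.2.1, v.2.2)
    | .g => (v.1, v.2.1, 2 * p.2.2 - v.2.2)
    | .b => (v.1, 2 * p.2.1 - v.2.1, v.2.2)
  refine sum_binVec_eq_zero_of_involutive (σ := σ) (fun v => by cases c <;> simp [σ]) ?_
  intro v hv
  rw [Set.mem_iInter] at hv
  have hvp := hc ▸ hv c
  have hvs : ∀ c' ≠ c, v ∈ boundary d c' (s c') := fun c' hc' => hX c' hc' ▸ hv c'
  obtain ⟨hvB, hvS⟩ := mem_siteFinset.1 v.2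
  have hve := fun c' hc' => mem_boundary_emod_two (hvs c' hc')
  rw [mem_cellSupport hp.1] at hvp
  have hσs : ∀ c' ≠ c, axis c' (σ v.1) = axis c' v.1 := by
    intro c' hc'
    cases c <;> cases c' <;> first | rfl | exact absurd rfl hc'
  have hw : InBox d (σ v.1) ∧ IsSite (σ v.1) ∧ σ v.1 ≠ v.1 := by
    have hr := hve .r
    have hg := hve .g
    have hb := hve .b
    rw [ne_eq, Prod.ext_iff, Prod.ext_iff]
    clear hve hvs hσs hX hc hv
    cases c <;> simp only [axis, ne_eq, reduceCtorEq, not_true_eq_false, not_false_eq_true,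
      IsEmpty.forall_iff, forall_const] at hr hg hb <;>
      simp only [IsCell, IsCentre, IsFlattened, or_false, Int.even_iff, Int.odd_iff] at hp <;>
      simp only [isSite_iff, InBox, side, σ] at hp hvB hvS ⊢ <;> refine ⟨?_, ?_, ?_⟩ <;> omega
  refine ⟨⟨σ v.1, mem_siteFinset.2 ⟨hw.1, hw.2.1⟩⟩, Set.mem_iInter.2 fun c' => ?_, rfl,
    Subtype.coe_ne_coe.1 hw.2.2⟩
  obtain rfl | hc' := eq_or_ne c' c
  · rw [hc, mem_cellSupport hp.1]
    cases c' <;> dsimp only [σ] <;> omega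
  · rw [hX c' hc', mem_boundary, hσs c' hc']
    exact hvs c' hc'

theorem sum_binVec_boundaries (hd : 0 < d) (s : Colour → Bool) :
    ∑ v, binVec d (⋂ c, boundary d c (s c)) v = 1 := by
  let z : Colour → ℤ := fun c => if s c then side d else 0
  have hz : ∀ c, z c % 2 = 0 ∧ 0 ≤ z c ∧ z c ≤ side d := fun c => by
    simp only [z, side]
    split_ifs <;> omega
  let v₀ : Vertex d := ⟨(z .r, z .b, z .g), mem_siteFinset.2
    ⟨⟨(hz .r).2, (hz .b).2, (hz .g).2⟩, .inl ⟨Int.even_iff.2 (hz .g).1, Int.even_iff.2 (hz .r).1,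
      Int.even_iff.2 (hz .b).1⟩⟩⟩
  have h : ⋂ c, boundary d c (s c) = {v₀} := by
    ext v
    simp only [Set.mem_iInter, mem_boundary, Set.mem_singleton_iff, Subtype.ext_iff, Prod.ext_iff]
    exact ⟨fun h => ⟨h .r, h .b, h .g⟩, fun ⟨hr, hb, hg⟩ c => by cases c <;> assumption⟩
  classical simp [h, binVec, Set.indicator_apply]

theorem map_eq_zero_of_mem_span {R ι N : Type*} {M : ι → Type*} [Semiring R] [Finite ι]
    [∀ i, AddCommMonoid (M i)] [∀ i, Module R (M i)] [AddCommMonoid N] [Module R N]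
    (f : MultilinearMap R M N) {A : ∀ i, Set (M i)} (hf : ∀ x, (∀ i, x i ∈ A i) → f x = 0)
    {x : ∀ i, M i} (hx : ∀ i, x i ∈ Submodule.span R (A i)) : f x = 0 := by
  classical
  cases nonempty_fintype ι
  suffices h : ∀ (T : Finset ι) (x : ∀ i, M i), (∀ i ∈ T, x i ∈ Submodule.span R (A i)) →
      (∀ i ∉ T, x i ∈ A i) → f x = 0 from
    h .univ x (fun i _ => hx i) fun i hi => absurd (Finset.mem_univ i) hi
  intro T
  induction T using Finset.induction with
  | empty => exact fun x _ h => hf x fun i => h i (Finset.notMem_empty i)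
  | insert j T hj ih =>
    intro x hT hA
    have hupdate : ∀ y ∈ Submodule.span R (A j), f (Function.update x j y) = 0 := by
      intro y hy
      induction hy using Submodule.span_induction with
      | mem y hy =>
        refine ih _ (fun i hi => ?_) fun i hi => ?_
        · rw [Function.update_of_ne (ne_of_mem_of_not_mem hi hj)]
          exact hT i (Finset.mem_insert_of_mem hi)
        · obtain rfl | hij := eq_or_ne i j
          · rwa [Function.update_self]
          · rw [Function.update_of_ne hij]
            exact hA i (by simp [hij, hi])
      | zero => exact f.map_update_zero x j
      | add y z _ _ hy hz => rw [f.map_update_add, hy, hz, add_zero]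
      | smul r y _ hy => rw [f.map_update_smul, hy, smul_zero]
    simpa using hupdate (x j) (hT j (Finset.mem_insert_self j T))

/-- The trilinear form `∑ v, x .r v * x .g v * x .b v`, which counts collisions modulo two. -/
noncomputable def collisionForm (d : ℕ) :
    MultilinearMap (ZMod 2) (fun _ : Colour => Vertex d → ZMod 2) (ZMod 2) :=
  ∑ v, (MultilinearMap.mkPiAlgebra (ZMod 2) Colour (ZMod 2)).compLinearMap fun _ =>
    LinearMap.proj v

theorem collisionForm_apply (x : Colour → Vertex d → ZMod 2) :
    collisionForm d x = ∑ v, ∏ c, x c v := by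
  simp [collisionForm]

theorem natCast_collisions (x : Colour → Vertex d → ZMod 2) :
    (collisions d x : ZMod 2) = collisionForm d x := by
  have hprod : ∀ y : Colour → ZMod 2, (if ∀ c, y c = 1 then 1 else 0) = ∏ c, y c := by decide
  simp only [collisions, Finset.natCast_card_filter, collisionForm_apply, hprod]

theorem collisionForm_binVec (X : Colour → Set (Vertex d)) :
    collisionForm d (fun c => binVec d (X c)) = ∑ v, binVec d (⋂ c, X c) v := by
  classical
  rw [collisionForm_apply]
  refine Finset.sum_congr rfl fun v _ => ?_
  simp [binVec, Set.indicator_apply, Finset.prod_ite_zero]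

theorem iInter_colour {α : Type*} (X : Colour → Set α) : ⋂ c, X c = X .r ∩ X .g ∩ X .b := by
  ext a
  simp only [Set.mem_iInter, Set.mem_inter_iff]
  exact ⟨fun h => ⟨⟨h .r, h .g⟩, h .b⟩, fun h c => by cases c <;> simp [h]⟩

theorem collisionForm_binVec_eq_zero {s : Colour → Bool} {X : Colour → Set (Vertex d)}
    (hX : ∀ c, X c = boundary d c (s c) ∨ X c ∈ xSupports d c) (hcell : ∃ c, X c ∈ xSupports d c) :
    collisionForm d (fun c => binVec d (X c)) = 0 := by
  rw [collisionForm_binVec]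
  rcases hX .r with hr | ⟨p, hp, hr⟩ <;> rcases hX .g with hg | ⟨o, ho, hg⟩ <;>
    rcases hX .b with hb | ⟨q, hq, hb⟩
  · obtain ⟨c, p, hp, hc⟩ := hcell
    exact sum_binVec_cell_boundaries hp hc fun c' _ => by cases c' <;> assumption
  · exact sum_binVec_cell_boundaries hq hb fun c _ => by
      cases c <;> first | assumption | contradiction
  · exact sum_binVec_cell_boundaries ho hg fun c _ => by
      cases c <;> first | assumption | contradiction
  · rw [iInter_colour, hr, hg, hb, sum_binVec_cells_boundary_r hq ho]
  · exact sum_binVec_cell_boundaries hp hr fun c _ => by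
      cases c <;> first | assumption | contradiction
  · rw [iInter_colour, hr, hg, hb,
      sum_binVec_cells_boundary_g hp.1 hq.1 (inBox_or_inBox hp hq)]
  · rw [iInter_colour, hr, hg, hb, sum_binVec_cells_boundary_b hp ho]
  · rw [iInter_colour, hr, hg, hb,
      sum_binVec_cells_eq_zero hp.1 ho.1 hq.1 (ho.2.resolve_right id) (inBox_or_inBox hp hq)]

theorem collisionForm_boundary (hd : 0 < d) (s : Colour → Bool) :
    collisionForm d (fun c => binVec d (boundary d c (s c))) = 1 :=
  (collisionForm_binVec _).trans (sum_binVec_boundaries hd s)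

theorem collisionForm_xCoset (hd : 0 < d) {s : Colour → Bool} {a : Colour → ZMod 2}
    {x : Colour → Vertex d → ZMod 2} (hx : ∀ c, x c ∈ xCoset d s c (a c)) :
    collisionForm d x = ∏ c, a c := by
  classical
  choose h hh hx using hx
  rw [show x = (fun c => a c • binVec d (boundary d c (s c))) + h from funext hx,
    MultilinearMap.map_add_univ, Finset.sum_eq_single_of_mem Finset.univ (Finset.mem_univ _)]
  · rw [Finset.piecewise_univ, MultilinearMap.map_smul_univ, collisionForm_boundary hd, smul_eq_mul,
      mul_one]
  · intro T _ hT
    obtain ⟨c₀, hc₀⟩ := not_forall.1 fun h => hT (Finset.eq_univ_iff_forall.2 h)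
    refine map_eq_zero_of_mem_span _ (A := fun c => binVec d ''
      if c ∈ T then {boundary d c (s c)} else xSupports d c) (fun y hy => ?_) fun c => ?_
    · choose X hX hXy using hy
      obtain rfl : (fun c => binVec d (X c)) = y := funext hXy
      refine collisionForm_binVec_eq_zero (s := s) (fun c => ?_) ⟨c₀, by simpa [hc₀] using hX c₀⟩
      have := hX c
      split_ifs at this
      exacts [.inl this, .inr this]
    · by_cases hc : c ∈ T
      · simpa [hc] using Submodule.smul_mem _ _ (Submodule.mem_span_singleton_self _)
      · simpa [hc] using! hh c

theorem odd_collisions_iff (hd : 0 < d) {s : Colour → Bool} {a : Colour → ZMod 2}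
    {x : Colour → Vertex d → ZMod 2} (hx : ∀ c, x c ∈ xCoset d s c (a c)) :
    Odd (collisions d x) ↔ ∀ c, a c = 1 := by
  rw [← ZMod.natCast_eq_one_iff_odd, natCast_collisions, collisionForm_xCoset hd hx]
  clear hx
  decide +revert

/-- The binary vectors whose `X`-type operators commute with the `Z` stabilizers of the code `c`:
those which meet every `Z` stabilizer in an even number of vertices. -/
noncomputable def zKernel (d : ℕ) (c : Colour) : Submodule (ZMod 2) (Vertex d → ZMod 2) :=
  ⨅ S ∈ zSupports d c, LinearMap.ker (dotProductBilin (ZMod 2) (ZMod 2) (binVec d S))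

theorem mem_zKernel {c : Colour} {w : Vertex d → ZMod 2} :
    w ∈ zKernel d c ↔ ∀ S ∈ zSupports d c, binVec d S ⬝ᵥ w = 0 := by
  simp [zKernel]

theorem binVec_dotProduct_binVec (S T : Set (Vertex d)) :
    binVec d S ⬝ᵥ binVec d T = ∑ v, binVec d (S ∩ T) v := by
  simp only [dotProduct, binVec, Set.inter_indicator_one, Pi.mul_apply]

theorem binVec_mem_zKernel_of_mem_xSupports {c : Colour} {T : Set (Vertex d)}
    (hT : T ∈ xSupports d c) : binVec d T ∈ zKernel d c := by
  obtain ⟨p, hp, rfl⟩ := hT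
  rw [mem_zKernel]
  intro S hS
  rw [binVec_dotProduct_binVec]
  cases c
  · obtain ⟨q, o, hq, ho, -, rfl⟩ := hS
    rw [Set.inter_comm, Set.inter_comm (cellSupport d .b q), ← Set.inter_assoc]
    exact sum_binVec_cells_eq_zero hp.1 ho.1 hq.1 (ho.2.resolve_right id) (inBox_or_inBox hp hq)
  · obtain ⟨-, p', q, hp', hq, hpq, -, rfl⟩ := hS
    rw [Set.inter_right_comm]
    exact sum_binVec_cells_eq_zero hp' hp.1 hq (hp.2.resolve_right id) fun _ => hpq
  · obtain ⟨p', o, hp', ho, -, rfl⟩ := hS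
    exact sum_binVec_cells_eq_zero hp'.1 ho.1 hp.1 (ho.2.resolve_right id) (inBox_or_inBox hp' hp)

theorem binVec_boundary_mem_zKernel (c : Colour) (s : Bool) :
    binVec d (boundary d c s) ∈ zKernel d c := by
  rw [mem_zKernel]
  intro S hS
  rw [binVec_dotProduct_binVec]
  cases c
  · obtain ⟨q, o, hq, ho, -, rfl⟩ := hS
    rw [Set.inter_comm, Set.inter_comm (cellSupport d .b q), ← Set.inter_assoc]
    exact sum_binVec_cells_boundary_r hq ho s
  · obtain ⟨-, p, q, hp, hq, hpq, -, rfl⟩ := hS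
    rw [Set.inter_right_comm]
    exact sum_binVec_cells_boundary_g hp hq (fun _ => hpq) s
  · obtain ⟨p, o, hp, ho, -, rfl⟩ := hS
    exact sum_binVec_cells_boundary_b hp ho s

theorem xSpan_le_zKernel (c : Colour) : xSpan d c ≤ zKernel d c := by
  rw [xSpan, Submodule.span_le, Set.image_subset_iff]
  exact fun T => binVec_mem_zKernel_of_mem_xSupports

theorem xCoset_subset_zKernel (s : Colour → Bool) (c : Colour) (a : ZMod 2) :
    xCoset d s c a ⊆ zKernel d c := by
  rintro _ ⟨h, hh, rfl⟩
  exact add_mem (Submodule.smul_mem _ _ (binVec_boundary_mem_zKernel c _)) (xSpan_le_zKernel c hh)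

/-- Exchanges the two colours of the cuboctahedra. -/
def Colour.swap : Colour → Colour
  | .r => .b
  | .g => .g
  | .b => .r

/-- Two vertices of the same height along the axis `c`, such that some `Z` stabilizer of the code
`c` acts on them, and otherwise on lower vertices only. -/
def Linked (c : Colour) (v v' : Vertex d) : Prop :=
  axis c v.1 = axis c v'.1 ∧ ∃ S ∈ zSupports d c, v ∈ S ∧ v' ∈ S ∧
    ∀ u ∈ S, u = v ∨ u = v' ∨ axis c u.1 < axis c v.1

theorem Linked.symm {c : Colour} {v v' : Vertex d} (h : Linked c v v') : Linked c v' v := by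
  obtain ⟨hax, S, hS, hv, hv', hlow⟩ := h
  exact ⟨hax.symm, S, hS, hv', hv, fun u hu => hax ▸ or_left_comm.1 (hlow u hu)⟩

theorem sq_sub_eq_one {a b x : ℤ} (hab : a % 2 ≠ b % 2) (ha : a - 1 ≤ x ∧ x ≤ a + 1)
    (hb : b - 1 ≤ x ∧ x ≤ b + 1) : (a - b) ^ 2 = 1 := by
  obtain h | h : a - b = 1 ∨ a - b = -1 := by omega
  all_goals rw [h]; rfl

theorem eq_or_eq_of_mem_balls {a b x : ℤ} (hab : a % 2 ≠ b % 2) (ha : a - 1 ≤ x ∧ x ≤ a + 1)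
    (hb : b - 1 ≤ x ∧ x ≤ b + 1) : x = a ∨ x = b := by
  omega

theorem centre_emod_two_ne {c : Colour} (hc : c ≠ .g) {p o : Point} (hp : IsCentre c p)
    (ho : IsCentre .g o) :
    p.1 % 2 ≠ o.1 % 2 ∧ p.2.1 % 2 ≠ o.2.1 % 2 ∧ p.2.2 % 2 ≠ o.2.2 % 2 := by
  simp only [IsCentre, Int.even_iff, Int.odd_iff] at ho
  cases c
  · simp [hp.1, hp.2.1, hp.2.2.1, ho, Int.odd_iff.1, Int.even_iff.1]
  · contradiction
  · simp [hp.1, hp.2.1, hp.2.2.1, ho, Int.odd_iff.1, Int.even_iff.1]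

theorem sqDist_eq_three {c : Colour} (hc : c ≠ .g) {p o : Point} (hp : IsCentre c p)
    (ho : IsCentre .g o) (hpo : (cellSupport d c p ∩ cellSupport d .g o).Nonempty) :
    sqDist p o = 3 := by
  obtain ⟨v, hvp, hvo⟩ := hpo
  obtain ⟨hx, hy, hz⟩ := centre_emod_two_ne hc hp ho
  rw [mem_cellSupport hp] at hvp
  rw [mem_cellSupport ho] at hvo
  rw [sqDist, sq_sub_eq_one hx hvp.1 hvo.1, sq_sub_eq_one hy hvp.2.1 hvo.2.1,
    sq_sub_eq_one hz hvp.2.2 hvo.2.2]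
  rfl

theorem eq_of_mem_cells {c : Colour} (hc : c ≠ .g) {p o : Point} (hp : IsCentre c p)
    (ho : IsCentre .g o) {v : Vertex d} (hv : v ∈ cellSupport d c p ∩ cellSupport d .g o) :
    v.1 = (p.1, o.2.1, o.2.2) ∨ v.1 = (o.1, p.2.1, o.2.2) ∨ v.1 = (o.1, o.2.1, p.2.2) := by
  obtain ⟨hvp, hvo⟩ := hv
  obtain ⟨hpx, hpy, hpz⟩ := centre_emod_two_ne hc hp ho
  rw [mem_cellSupport hp] at hvp
  rw [mem_cellSupport ho] at hvo
  have hx := eq_or_eq_of_mem_balls hpx hvp.1 hvo.1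
  have hy := eq_or_eq_of_mem_balls hpy hvp.2.1 hvo.2.1
  have hz := eq_or_eq_of_mem_balls hpz hvp.2.2 hvo.2.2
  have hvS := isSite_iff.1 (mem_siteFinset.1 v.2).2
  simp only [IsCentre, Int.even_iff, Int.odd_iff] at ho
  clear hp hvp hvo
  rcases hx with hx | hx <;> rcases hy with hy | hy <;> rcases hz with hz | hz <;>
    rw [hx, hy, hz] at hvS
  · omega
  · omega
  · omega
  · exact .inl (Prod.ext hx (Prod.ext hy hz))
  · omega
  · exact .inr (.inl (Prod.ext hx (Prod.ext hy hz)))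
  · exact .inr (.inr (Prod.ext hx (Prod.ext hy hz)))
  · omega

theorem cells_inter_mem_zSupports {c : Colour} (hc : c ≠ .g) {p o : Point}
    (hp : IsCell d c.swap p) (ho : IsCell d .g o)
    (hpo : (cellSupport d c.swap p ∩ cellSupport d .g o).Nonempty) :
    cellSupport d c.swap p ∩ cellSupport d .g o ∈ zSupports d c := by
  have hdist := sqDist_eq_three (by cases c <;> simp_all [Colour.swap]) hp.1 ho.1 hpo
  cases c
  · exact ⟨p, o, hp, ho, hdist, rfl⟩
  · contradiction
  · exact ⟨p, o, hp, ho, hdist, rfl⟩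

/-- The point at height `h` along the axis `c`, for a colour `c` of cuboctahedra, that has vertical
coordinate `z` and coordinate `t` along the remaining horizontal axis. -/
def place : Colour → ℤ → ℤ → ℤ → Point
  | .b, h, t, z => (t, h, z)
  | _, h, t, z => (h, t, z)

/-- The sum modulo four of the coordinates of a centre of a cuboctahedron of the given colour. -/
def residue : Colour → ℤ
  | .r => 2
  | _ => 0

theorem place_axis {c : Colour} (hc : c ≠ .g) (p : Point) :
    place c (axis c p) (axis c.swap p) p.2.2 = p := by
  cases c
  exacts [rfl, absurd rfl hc, rfl]

theorem axis_place {c : Colour} (hc : c ≠ .g) (h t z : ℤ) : axis c (place c h t z) = h := by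
  cases c
  exacts [rfl, absurd rfl hc, rfl]

theorem isCell_place_iff {c : Colour} (hc : c ≠ .g) {h t z : ℤ} :
    IsCell d c (place c h t z) ↔
      h % 2 = 1 ∧ t % 2 = 1 ∧ z % 2 = 0 ∧ (h + t + z) % 4 = residue c ∧
      (0 ≤ h ∧ h ≤ side d) ∧ (-1 ≤ t ∧ t ≤ side d + 1) ∧ (0 ≤ z ∧ z ≤ side d) := by
  cases c
  case g => contradiction
  all_goals
    simp only [IsCell, IsCentre, IsFlattened, InBox, place, residue, side, Int.even_iff,
      Int.odd_iff]
    omega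

theorem isCell_swap_place_iff {c : Colour} (hc : c ≠ .g) {h t z : ℤ} :
    IsCell d c.swap (place c h t z) ↔
      h % 2 = 1 ∧ t % 2 = 1 ∧ z % 2 = 0 ∧ (h + t + z) % 4 = residue c.swap ∧
      (-1 ≤ h ∧ h ≤ side d + 1) ∧ (0 ≤ t ∧ t ≤ side d) ∧ (0 ≤ z ∧ z ≤ side d) := by
  cases c
  case g => contradiction
  all_goals
    simp only [IsCell, IsCentre, IsFlattened, InBox, place, residue, Colour.swap, side,
      Int.even_iff, Int.odd_iff]
    omega

theorem isCell_g_place_iff {c : Colour} (hc : c ≠ .g) {h t z : ℤ} :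
    IsCell d .g (place c h t z) ↔ h % 2 = 0 ∧ t % 2 = 0 ∧ z % 2 = 1 ∧
      (0 ≤ h ∧ h ≤ side d) ∧ (0 ≤ t ∧ t ≤ side d) ∧ (0 ≤ z ∧ z ≤ side d) := by
  cases c
  case g => contradiction
  all_goals
    simp only [IsCell, IsCentre, IsFlattened, InBox, place, or_false, Int.even_iff, Int.odd_iff]
    omega

theorem place_mem_siteFinset {c : Colour} (hc : c ≠ .g) {h t z : ℤ} :
    place c h t z ∈ siteFinset d ↔ (h + t + z) % 2 = 0 ∧ ¬ (h % 2 = 1 ∧ t % 2 = 1 ∧ z % 2 = 0) ∧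
      (0 ≤ h ∧ h ≤ side d) ∧ (0 ≤ t ∧ t ≤ side d) ∧ (0 ≤ z ∧ z ≤ side d) := by
  rw [mem_siteFinset, isSite_iff]
  cases c
  case g => contradiction
  all_goals
    simp only [InBox, place]
    omega

theorem mem_cellSupport_place {c c' : Colour} (hc : c ≠ .g) {h t z h' t' z' : ℤ}
    (hp : IsCentre c' (place c h t z)) (hv : place c h' t' z' ∈ siteFinset d) :
    ⟨place c h' t' z', hv⟩ ∈ cellSupport d c' (place c h t z) ↔
      (h - 1 ≤ h' ∧ h' ≤ h + 1) ∧ (t - 1 ≤ t' ∧ t' ≤ t + 1) ∧ (z - 1 ≤ z' ∧ z' ≤ z + 1) := by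
  rw [mem_cellSupport hp]
  cases c
  exacts [Iff.rfl, absurd rfl hc, and_left_comm]

theorem exists_eq_place {c : Colour} (hc : c ≠ .g) (v : Vertex d) :
    ∃ h t z, ∃ hv : place c h t z ∈ siteFinset d, v = ⟨place c h t z, hv⟩ :=
  ⟨_, _, _, (place_axis hc v.1).symm ▸ v.2, Subtype.ext (place_axis hc v.1).symm⟩

theorem swap_ne_g {c : Colour} (hc : c ≠ .g) : c.swap ≠ .g := by
  cases c
  exacts [nofun, absurd rfl hc, nofun]

theorem eq_place_of_mem_cells {c : Colour} (hc : c ≠ .g) {h t z h' t' z' : ℤ}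
    (hp : IsCentre c.swap (place c h t z)) (ho : IsCentre .g (place c h' t' z')) {v : Vertex d}
    (hv : v ∈ cellSupport d c.swap (place c h t z) ∩ cellSupport d .g (place c h' t' z')) :
    v.1 = place c h t' z' ∨ v.1 = place c h' t z' ∨ v.1 = place c h' t' z := by
  have := eq_of_mem_cells (swap_ne_g hc) hp ho hv
  cases c
  exacts [this, absurd rfl hc, or_left_comm.1 this]

theorem linked_place {c : Colour} (hc : c ≠ .g) {h t z h' t' z' : ℤ}
    (hp : IsCell d c.swap (place c h t z)) (ho : IsCell d .g (place c h' t' z'))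
    (hh : h = h' - 1 ∨ h = h' + 1 ∧ h' = side d) (ht : t = t' - 1 ∨ t = t' + 1)
    (hz : z = z' - 1 ∨ z = z' + 1) (hv : place c h' t z' ∈ siteFinset d)
    (hv' : place c h' t' z ∈ siteFinset d) :
    Linked c (⟨place c h' t z', hv⟩ : Vertex d) ⟨place c h' t' z, hv'⟩ := by
  have hvS : ⟨place c h' t z', hv⟩ ∈
      cellSupport d c.swap (place c h t z) ∩ cellSupport d .g (place c h' t' z') := by
    rw [Set.mem_inter_iff, mem_cellSupport_place hc hp.1, mem_cellSupport_place hc ho.1]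
    omega
  refine ⟨by rw [axis_place hc, axis_place hc], _, cells_inter_mem_zSupports hc hp ho ⟨_, hvS⟩, hvS,
    ?_, fun u hu => ?_⟩
  · rw [Set.mem_inter_iff, mem_cellSupport_place hc hp.1, mem_cellSupport_place hc ho.1]
    omega
  · obtain hu | hu | hu := eq_place_of_mem_cells hc hp.1 ho.1 hu
    · have huB := (place_mem_siteFinset hc).1 (hu ▸ u.2)
      refine .inr (.inr ?_)
      rw [hu, axis_place hc, axis_place hc]
      omega
    · exact .inl (Subtype.ext hu)
    · exact .inr (.inl (Subtype.ext hu))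

theorem exists_add_emod_four_eq_residue (c : Colour) {k : ℤ} (hk : k % 2 = 1) :
    ∃ e : ℤ, (e = 1 ∨ e = -1) ∧ (k + e) % 4 = residue c := by
  have hc : residue c = 0 ∨ residue c = 2 := by cases c <;> decide
  by_cases h : (k + 1) % 4 = residue c
  exacts [⟨1, .inl rfl, h⟩, ⟨-1, .inr rfl, by omega⟩]

theorem exists_offset_mem_Icc {t L : ℤ} (ht : 0 ≤ t ∧ t ≤ L) (hL : 2 ≤ L) :
    ∃ a : ℤ, (a = 1 ∨ a = -1) ∧ 0 ≤ t + a ∧ t + a ≤ L := by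
  by_cases h : t = 0
  exacts [⟨1, .inl rfl, by omega⟩, ⟨-1, .inr rfl, by omega⟩]

theorem residue_swap {c : Colour} (hc : c ≠ .g) : residue c.swap = (residue c + 2) % 4 := by
  cases c
  exacts [rfl, absurd rfl hc, rfl]

theorem side_emod_two : side d % 2 = 0 := by
  simp only [side]
  omega

theorem exists_zSupport_below_of_ne_g {c : Colour} (hc : c ≠ .g) {v : Vertex d}
    (hv : axis c v.1 % 2 = 1) :
    ∃ S ∈ zSupports d c, v ∈ S ∧ ∀ u ∈ S, u = v ∨ axis c u.1 < axis c v.1 := by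
  obtain ⟨h, t, z, hm, rfl⟩ := exists_eq_place hc v
  rw [axis_place hc] at hv ⊢
  have hB := (place_mem_siteFinset hc).1 hm
  have hL := side_emod_two (d := d)
  obtain ⟨a, ha, haB⟩ := exists_offset_mem_Icc hB.2.2.2.1 (by omega)
  obtain ⟨e, he, hres⟩ := exists_add_emod_four_eq_residue c.swap (k := h + (t + a) + z) (by omega)
  have hp : IsCell d c.swap (place c h (t + a) (z + e)) := by
    rw [isCell_swap_place_iff hc]
    omega
  have ho : IsCell d .g (place c (h - 1) t z) := by
    rw [isCell_g_place_iff hc]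
    omega
  have hmem : ⟨place c h t z, hm⟩ ∈ cellSupport d c.swap (place c h (t + a) (z + e)) ∩
      cellSupport d .g (place c (h - 1) t z) := by
    rw [Set.mem_inter_iff, mem_cellSupport_place hc hp.1, mem_cellSupport_place hc ho.1]
    omega
  refine ⟨_, cells_inter_mem_zSupports hc hp ho ⟨_, hmem⟩, hmem, fun u hu => ?_⟩
  obtain hu | hu | hu := eq_place_of_mem_cells hc hp.1 ho.1 hu
  · exact .inl (Subtype.ext hu)
  all_goals
    rw [hu, axis_place hc]
    exact .inr (sub_one_lt h)

theorem sqDist_place_zero (c : Colour) (h t z : ℤ) :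
    sqDist (place c h t z) 0 = h ^ 2 + t ^ 2 + z ^ 2 := by
  cases c <;> simp only [sqDist, place, Prod.fst_zero, Prod.snd_zero, sub_zero]
  ring

theorem exists_linked_top {c : Colour} (hc : c ≠ .g) {t z t' z' : ℤ}
    (ht : t = t' - 1 ∨ t = t' + 1) (hz : z = z' - 1 ∨ z = z' + 1)
    (hv : place c (side d) t z ∈ siteFinset d) (hv' : place c (side d) t' z' ∈ siteFinset d) :
    Linked c (⟨place c (side d) t z, hv⟩ : Vertex d) ⟨place c (side d) t' z', hv'⟩ := by
  wlog hodd : z % 2 = 1 generalizing t z t' z'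
  · exact (this (by omega) (by omega) hv' hv (by omega)).symm
  have hB := (place_mem_siteFinset hc).1 hv
  have hB' := (place_mem_siteFinset hc).1 hv'
  have hL := side_emod_two (d := d)
  obtain ⟨e, he, hres⟩ := exists_add_emod_four_eq_residue c.swap (k := side d + t + z') (by omega)
  exact linked_place hc (h := side d + e) ((isCell_swap_place_iff hc).2 (by omega))
    ((isCell_g_place_iff hc).2 (by omega)) (by omega) ht (by omega) hv hv'

theorem exists_linked_nearer_of_ne_g {c : Colour} (hc : c ≠ .g) {v : Vertex d}
    (hv : axis c v.1 = side d) (hne : ∃ c' ≠ c, axis c' v.1 ≠ 0) :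
    ∃ v', Linked c v v' ∧ sqDist v'.1 0 < sqDist v.1 0 := by
  obtain ⟨h, t, z, hm, rfl⟩ := exists_eq_place hc v
  obtain rfl : h = side d := (axis_place hc h t z).symm.trans hv
  have htz : t ≠ 0 ∨ z ≠ 0 := by
    obtain ⟨c', hc', h⟩ := hne
    cases c <;> cases c' <;> simp_all [axis, place]
  have hB := (place_mem_siteFinset hc).1 hm
  have hL := side_emod_two (d := d)
  have hm' : place c (side d) (t - 1).natAbs (z - 1).natAbs ∈ siteFinset d :=
    (place_mem_siteFinset hc).2 (by omega)
  refine ⟨⟨_, hm'⟩, exists_linked_top hc (by omega) (by omega) hm hm', ?_⟩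
  simp only [sqDist_place_zero, Int.natAbs_sq]
  nlinarith [show 2 ≤ t + z by omega]

theorem existsUnique_cell_above_of_ne_g {c : Colour} (hc : c ≠ .g) {v : Vertex d}
    (hv : axis c v.1 % 2 = 0) (hlt : axis c v.1 < side d) :
    ∃! p, IsCell d c p ∧ axis c p = axis c v.1 + 1 ∧ v ∈ cellSupport d c p := by
  obtain ⟨h, t, z, hm, rfl⟩ := exists_eq_place hc v
  rw [axis_place hc] at hv hlt ⊢
  have hB := (place_mem_siteFinset hc).1 hm
  have hL := side_emod_two (d := d)
  obtain ⟨e, he, hres⟩ := exists_add_emod_four_eq_residue c (k := h + 1 + t + z) (by omega)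
  refine existsUnique_of_exists_of_unique ?_ ?_
  · obtain ⟨t', z', htz⟩ : ∃ t' z', z % 2 = 0 ∧ t' = t + e ∧ z' = z ∨
        z % 2 = 1 ∧ t' = t ∧ z' = z + e := by
      obtain hz | hz := Int.emod_two_eq_zero_or_one z
      exacts [⟨_, _, .inl ⟨hz, rfl, rfl⟩⟩, ⟨_, _, .inr ⟨hz, rfl, rfl⟩⟩]
    have hp : IsCell d c (place c (h + 1) t' z') := (isCell_place_iff hc).2 (by omega)
    exact ⟨_, hp, axis_place hc _ _ _, (mem_cellSupport_place hc hp.1 hm).2 (by omega)⟩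
  · rintro p q ⟨hp, hph, hvp⟩ ⟨hq, hqh, hvq⟩
    rw [← place_axis hc p, hph] at hp hvp ⊢
    rw [← place_axis hc q, hqh] at hq hvq ⊢
    rw [mem_cellSupport_place hc hp.1] at hvp
    rw [mem_cellSupport_place hc hq.1] at hvq
    rw [isCell_place_iff hc] at hp hq
    congr 1 <;> omega

theorem linked_of_mem_cell {c : Colour} (hc : c ≠ .g) {h t z t' z' : ℤ}
    (hp : IsCell d c (place c (h + 1) t z)) (ht' : t' = t - 1 ∨ t' = t + 1)
    (hz' : z' = z - 1 ∨ z' = z + 1) (hv : place c h t z' ∈ siteFinset d)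
    (hv' : place c h t' z ∈ siteFinset d) :
    Linked c (⟨place c h t z', hv⟩ : Vertex d) ⟨place c h t' z, hv'⟩ := by
  have hB := (place_mem_siteFinset hc).1 hv
  have hB' := (place_mem_siteFinset hc).1 hv'
  have hp' := (isCell_place_iff hc).1 hp
  refine linked_place hc (h := h - 1) ((isCell_swap_place_iff hc).2 ?_)
    ((isCell_g_place_iff hc).2 ?_) (.inl rfl) (by omega) (by omega) hv hv'
  · rw [residue_swap hc]
    clear ht' hz' hB'
    omega
  · clear hp
    omega

theorem reflTransGen_linked_of_mem_cell_of_ne_g {c : Colour} (hc : c ≠ .g) {p : Point}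
    (hp : IsCell d c p) {v v' : Vertex d} (hv : axis c v.1 = axis c p - 1)
    (hv' : axis c v'.1 = axis c p - 1) (hvp : v ∈ cellSupport d c p)
    (hvp' : v' ∈ cellSupport d c p) : Relation.ReflTransGen (Linked c) v v' := by
  obtain ⟨h, t, z, rfl⟩ : ∃ h t z, p = place c (h + 1) t z :=
    ⟨axis c p - 1, _, _, by rw [sub_add_cancel, place_axis hc]⟩
  obtain ⟨h₁, t₁, z₁, hm₁, rfl⟩ := exists_eq_place hc v
  obtain ⟨h₂, t₂, z₂, hm₂, rfl⟩ := exists_eq_place hc v'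
  rw [axis_place hc, axis_place hc, add_sub_cancel_right] at hv hv'
  obtain rfl : h = h₁ := hv.symm
  obtain rfl : h = h₂ := hv'.symm
  rw [mem_cellSupport_place hc hp.1] at hvp hvp'
  have hpar := (isCell_place_iff hc).1 hp
  have hL := side_emod_two (d := d)
  have hB₁ := (place_mem_siteFinset hc).1 hm₁
  have hB₂ := (place_mem_siteFinset hc).1 hm₂
  have classify {t' z' : ℤ} (ht : t - 1 ≤ t' ∧ t' ≤ t + 1) (hz : z - 1 ≤ z' ∧ z' ≤ z + 1)
      (hs : (t' + z') % 2 = 0) :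
      t' = t ∧ (z' = z - 1 ∨ z' = z + 1) ∨ (t' = t - 1 ∨ t' = t + 1) ∧ z' = z := by omega
  obtain ⟨rfl, hz₁⟩ | ⟨ht₁, rfl⟩ := classify hvp.2.1 hvp.2.2 (by omega) <;>
    obtain ⟨ht₂, hz₂⟩ | ⟨ht₂, hz₂⟩ := classify hvp'.2.1 hvp'.2.2 (by omega)
  · subst ht₂
    obtain ⟨a, ha, haB⟩ := exists_offset_mem_Icc hB₁.2.2.2.1 (by omega)
    have hm : place c h (t₂ + a) z ∈ siteFinset d := (place_mem_siteFinset hc).2 (by omega)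
    exact .tail (.single (linked_of_mem_cell hc hp (by omega) hz₁ hm₁ hm))
      (linked_of_mem_cell hc hp (by omega) hz₂ hm₂ hm).symm
  · subst hz₂
    exact .single (linked_of_mem_cell hc hp ht₂ hz₁ hm₁ hm₂)
  · subst ht₂
    exact .single (linked_of_mem_cell hc hp ht₁ hz₂ hm₂ hm₁).symm
  · subst hz₂
    obtain rfl | hne := eq_or_ne t₁ t₂
    · exact .refl
    obtain ⟨a, ha, haB⟩ := exists_offset_mem_Icc hB₁.2.2.2.2 (by omega)
    have hm : place c h t (z₂ + a) ∈ siteFinset d := (place_mem_siteFinset hc).2 (by omega)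
    exact .tail (.single (linked_of_mem_cell hc hp ht₁ (by omega) hm hm₁).symm)
      (linked_of_mem_cell hc hp ht₂ (by omega) hm hm₂)

theorem axis_g_place (c : Colour) (h t z : ℤ) : axis .g (place c h t z) = z := by
  cases c <;> rfl

theorem isCentre_place_iff {c c' : Colour} (hc : c ≠ .g) (hc' : c' ≠ .g) {h t z : ℤ} :
    IsCentre c' (place c h t z) ↔
      h % 2 = 1 ∧ t % 2 = 1 ∧ z % 2 = 0 ∧ (h + t + z) % 4 = residue c' := by
  cases c <;> cases c' <;>
    simp only [ne_eq, not_true_eq_false, IsCentre, place, residue, Int.even_iff, Int.odd_iff]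
      at hc hc' ⊢ <;> omega

theorem inBox_place_iff (c : Colour) {h t z : ℤ} : InBox d (place c h t z) ↔
    (0 ≤ h ∧ h ≤ side d) ∧ (0 ≤ t ∧ t ≤ side d) ∧ (0 ≤ z ∧ z ≤ side d) := by
  cases c
  exacts [Iff.rfl, Iff.rfl, and_left_comm]

theorem sqDist_place (c : Colour) (h t z h' t' z' : ℤ) :
    sqDist (place c h t z) (place c h' t' z') = (h - h') ^ 2 + (t - t') ^ 2 + (z - z') ^ 2 := by
  cases c <;> simp only [sqDist, place]
  ring

theorem exists_square {c : Colour} (hc : c ≠ .g) {h t z : ℤ} (hh : h % 2 = 0) (ht : t % 2 = 1)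
    (hz : z % 2 = 0) (hbox : InBox d (place c h t z)) :
    ∃ S ∈ zSupports d .g, ∀ h' t' z' (hv : place c h' t' z' ∈ siteFinset d),
      ⟨place c h' t' z', hv⟩ ∈ S ↔
        h' = h ∧ (t - 1 ≤ t' ∧ t' ≤ t + 1) ∧ (z - 1 ≤ z' ∧ z' ≤ z + 1) := by
  obtain ⟨e, he, hres⟩ := exists_add_emod_four_eq_residue .r (k := h + t + z) (by omega)
  have hp : IsCentre .r (place c (h + e) t z) := (isCentre_place_iff hc (c' := .r) nofun).2
    (by simp only [residue] at hres ⊢; omega)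
  have hq : IsCentre .b (place c (h - e) t z) := (isCentre_place_iff hc (c' := .b) nofun).2
    (by simp only [residue] at hres ⊢; omega)
  have hmem : ∀ h' t' z' (hv : place c h' t' z' ∈ siteFinset d), ⟨place c h' t' z', hv⟩ ∈
      cellSupport d .r (place c (h + e) t z) ∩ cellSupport d .b (place c (h - e) t z) ↔
        h' = h ∧ (t - 1 ≤ t' ∧ t' ≤ t + 1) ∧ (z - 1 ≤ z' ∧ z' ≤ z + 1) := fun h' t' z' hv => by
    rw [Set.mem_inter_iff, mem_cellSupport_place hc hp, mem_cellSupport_place hc hq]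
    omega
  have hL := side_emod_two (d := d)
  rw [inBox_place_iff] at hbox
  have hcorner : place c h (t - 1) z ∈ siteFinset d := (place_mem_siteFinset hc).2 (by omega)
  refine ⟨_, ⟨⟨_, (hmem _ _ _ hcorner).2 (by omega)⟩, _, _, hp, hq, ?_, ?_, rfl⟩, hmem⟩
  · rw [inBox_place_iff, inBox_place_iff]
    omega
  · rw [sqDist_place]
    obtain rfl | rfl := he <;> ring

theorem exists_zSupport_below_g {v : Vertex d} (hv : axis .g v.1 % 2 = 1) :
    ∃ S ∈ zSupports d .g, v ∈ S ∧ ∀ u ∈ S, u = v ∨ axis .g u.1 < axis .g v.1 := by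
  obtain ⟨c, hc, h, t, z, hm, rfl, hh, ht⟩ : ∃ c ≠ Colour.g, ∃ h t z,
      ∃ hv : place c h t z ∈ siteFinset d, v = ⟨place c h t z, hv⟩ ∧ h % 2 = 0 ∧ t % 2 = 1 := by
    obtain ⟨⟨x, y, z⟩, hm⟩ := v
    have hB := (place_mem_siteFinset (c := .r) nofun).1 hm
    simp only [axis] at hv
    obtain hx | hx := Int.emod_two_eq_zero_or_one x
    · exact ⟨.r, nofun, x, y, z, hm, rfl, hx, by omega⟩
    · exact ⟨.b, nofun, y, x, z, hm, rfl, by omega, hx⟩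
  rw [axis_g_place] at hv ⊢
  have hB := (place_mem_siteFinset hc).1 hm
  obtain ⟨S, hS, hmem⟩ := exists_square hc hh ht (z := z - 1) (d := d) (by omega)
    ((inBox_place_iff c).2 (by omega))
  refine ⟨S, hS, (hmem _ _ _ hm).2 (by omega), fun u hu => ?_⟩
  obtain ⟨h', t', z', hm', rfl⟩ := exists_eq_place hc u
  have hu' := (hmem _ _ _ hm').1 hu
  have hB' := (place_mem_siteFinset hc).1 hm'
  rw [axis_g_place, Subtype.mk.injEq]
  by_cases hz : z' < z
  · exact .inr hz
  · exact .inl (by congr 1 <;> omega)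

theorem exists_linked_nearer_g {v : Vertex d} (hv : axis .g v.1 = side d)
    (hne : ∃ c ≠ .g, axis c v.1 ≠ 0) :
    ∃ v', Linked .g v v' ∧ sqDist v'.1 0 < sqDist v.1 0 := by
  obtain ⟨c', hc', hne⟩ := hne
  obtain ⟨c, hc, rfl⟩ : ∃ c ≠ Colour.g, c' = c.swap := ⟨c'.swap, swap_ne_g hc', by cases c' <;> rfl⟩
  obtain ⟨h, t, z, hm, rfl⟩ := exists_eq_place hc v
  obtain rfl : z = side d := (axis_g_place c h t z).symm.trans hv
  replace hne : t ≠ 0 := by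
    cases c
    exacts [hne, absurd rfl hc, hne]
  have hB := (place_mem_siteFinset hc).1 hm
  have hL := side_emod_two (d := d)
  obtain ⟨S, hS, hmem⟩ := exists_square hc (h := h) (t := t - 1) (z := side d) (d := d) (by omega)
    (by omega) (by omega) ((inBox_place_iff c).2 (by omega))
  have hm' : place c h (t - 2) (side d) ∈ siteFinset d := (place_mem_siteFinset hc).2 (by omega)
  refine ⟨⟨_, hm'⟩, ⟨by rw [axis_g_place, axis_g_place], S, hS, (hmem _ _ _ hm).2 (by omega),
    (hmem _ _ _ hm').2 (by omega), fun u hu => ?_⟩, ?_⟩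
  · obtain ⟨h₁, t₁, z₁, hm₁, rfl⟩ := exists_eq_place hc u
    have hu' := (hmem _ _ _ hm₁).1 hu
    have hB₁ := (place_mem_siteFinset hc).1 hm₁
    rw [axis_g_place, axis_g_place, Subtype.mk.injEq, Subtype.mk.injEq]
    by_cases hz : z₁ < side d
    · exact .inr (.inr hz)
    obtain ht | ht : t₁ = t ∨ t₁ = t - 2 := by omega
    · exact .inl (by congr 1 <;> omega)
    · exact .inr (.inl (by congr 1 <;> omega))
  · simp only [sqDist_place_zero]
    nlinarith [show 2 ≤ t by omega]

theorem eq_of_mem_cell_g {p : Point} (hp : IsCentre .g p) {v : Vertex d}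
    (hv : v ∈ cellSupport d .g p) (hz : axis .g v.1 % 2 = 0) :
    v.1.1 = p.1 ∧ v.1.2.1 = p.2.1 := by
  have hsite := isSite_iff.1 (mem_siteFinset.1 v.2).2
  rw [mem_cellSupport hp] at hv
  simp only [IsCentre, Int.even_iff, Int.odd_iff, axis] at hp hz
  omega

theorem existsUnique_cell_above_g {v : Vertex d} (hv : axis .g v.1 % 2 = 0)
    (hlt : axis .g v.1 < side d) :
    ∃! p, IsCell d .g p ∧ axis .g p = axis .g v.1 + 1 ∧ v ∈ cellSupport d .g p := by
  have hsite := mem_siteFinset.1 v.2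
  have hp : IsCell d .g (v.1.1, v.1.2.1, v.1.2.2 + 1) := by
    rw [isSite_iff] at hsite
    simp only [IsCell, IsCentre, IsFlattened, or_false, InBox, axis, Int.even_iff,
      Int.odd_iff] at hsite hv hlt ⊢
    omega
  refine ⟨_, ⟨hp, rfl, (mem_cellSupport hp.1).2 (by dsimp only; omega)⟩, fun q ⟨hq, hqz, hvq⟩ => ?_⟩
  obtain ⟨hx, hy⟩ := eq_of_mem_cell_g hq.1 hvq hv
  exact Prod.ext hx.symm (Prod.ext hy.symm hqz)

theorem exists_zSupport_below {c : Colour} {v : Vertex d} (hv : axis c v.1 % 2 = 1) :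
    ∃ S ∈ zSupports d c, v ∈ S ∧ ∀ u ∈ S, u = v ∨ axis c u.1 < axis c v.1 := by
  obtain rfl | hc := eq_or_ne c .g
  exacts [exists_zSupport_below_g hv, exists_zSupport_below_of_ne_g hc hv]

theorem exists_linked_nearer {c : Colour} {v : Vertex d} (hv : axis c v.1 = side d)
    (hne : ∃ c' ≠ c, axis c' v.1 ≠ 0) :
    ∃ v', Linked c v v' ∧ sqDist v'.1 0 < sqDist v.1 0 := by
  obtain rfl | hc := eq_or_ne c .g
  exacts [exists_linked_nearer_g hv hne, exists_linked_nearer_of_ne_g hc hv hne]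

theorem existsUnique_cell_above {c : Colour} {v : Vertex d} (hv : axis c v.1 % 2 = 0)
    (hlt : axis c v.1 < side d) :
    ∃! p, IsCell d c p ∧ axis c p = axis c v.1 + 1 ∧ v ∈ cellSupport d c p := by
  obtain rfl | hc := eq_or_ne c .g
  exacts [existsUnique_cell_above_g hv hlt, existsUnique_cell_above_of_ne_g hc hv hlt]

theorem reflTransGen_linked_of_mem_cell {c : Colour} {p : Point} (hp : IsCell d c p)
    {v v' : Vertex d} (hv : axis c v.1 = axis c p - 1) (hv' : axis c v'.1 = axis c p - 1)
    (hvp : v ∈ cellSupport d c p) (hvp' : v' ∈ cellSupport d c p) :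
    Relation.ReflTransGen (Linked c) v v' := by
  obtain rfl | hc := eq_or_ne c .g
  · have hpar : axis .g p % 2 = 1 := Int.odd_iff.1 hp.1.2.2
    obtain ⟨hx, hy⟩ := eq_of_mem_cell_g hp.1 hvp (by omega)
    obtain ⟨hx', hy'⟩ := eq_of_mem_cell_g hp.1 hvp' (by omega)
    obtain rfl : v = v' := Subtype.ext (Prod.ext (hx.trans hx'.symm)
      (Prod.ext (hy.trans hy'.symm) (hv.trans hv'.symm)))
    exact .refl
  · exact reflTransGen_linked_of_mem_cell_of_ne_g hc hp hv hv' hvp hvp'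

theorem axis_le_of_mem_cellSupport {c : Colour} {p : Point} (hp : IsCentre c p) {v : Vertex d}
    (hv : v ∈ cellSupport d c p) : axis c p ≤ axis c v.1 + 1 := by
  rw [mem_cellSupport hp] at hv
  cases c <;> simp only [axis] <;> omega

theorem axis_mem_Icc (c : Colour) (v : Vertex d) : 0 ≤ axis c v.1 ∧ axis c v.1 ≤ side d := by
  have h := (mem_siteFinset.1 v.2).1
  cases c
  exacts [h.1, h.2.2, h.2.1]

theorem eq_of_linked {c : Colour} {w : Vertex d → ZMod 2} (hw : w ∈ zKernel d c) {v v' : Vertex d}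
    (hlow : ∀ u, axis c u.1 < axis c v.1 → w u = 0) (h : Linked c v v') : w v = w v' := by
  obtain rfl | hne := eq_or_ne v v'
  · rfl
  obtain ⟨-, S, hS, hv, hv', hother⟩ := h
  have hsum := mem_zKernel.1 hw S hS
  rw [dotProduct, Fintype.sum_eq_add v v' hne fun u hu => ?_] at hsum
  · simpa [binVec, hv, hv', CharTwo.add_eq_zero] using hsum
  · by_cases huS : u ∈ S
    · rw [hlow u (((hother u huS).resolve_left hu.1).resolve_left hu.2), mul_zero]
    · rw [binVec, Set.indicator_of_notMem huS, zero_mul]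

theorem eq_of_reflTransGen_linked {c : Colour} {w : Vertex d → ZMod 2} (hw : w ∈ zKernel d c)
    {v v' : Vertex d} (hlow : ∀ u, axis c u.1 < axis c v.1 → w u = 0)
    (h : Relation.ReflTransGen (Linked c) v v') : w v = w v' := by
  induction h using Relation.ReflTransGen.head_induction_on with
  | refl => rfl
  | head h _ ih => exact (eq_of_linked hw hlow h).trans (ih (h.1 ▸ hlow))

theorem eq_zero_of_odd_height {c : Colour} {w : Vertex d → ZMod 2} (hw : w ∈ zKernel d c)
    {v : Vertex d} (hlow : ∀ u, axis c u.1 < axis c v.1 → w u = 0) (hv : axis c v.1 % 2 = 1) :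
    w v = 0 := by
  obtain ⟨S, hS, hvS, hother⟩ := exists_zSupport_below hv
  have hsum := mem_zKernel.1 hw S hS
  rw [dotProduct, Fintype.sum_eq_single v fun u hu => ?_] at hsum
  · simpa [binVec, hvS] using hsum
  · by_cases huS : u ∈ S
    · rw [hlow u ((hother u huS).resolve_left hu), mul_zero]
    · rw [binVec, Set.indicator_of_notMem huS, zero_mul]

theorem exists_xSpan_eq_on_even_layer {c : Colour} {w : Vertex d → ZMod 2} (hw : w ∈ zKernel d c)
    {n : ℤ} (hlow : ∀ u, axis c u.1 < n → w u = 0) (hn : n % 2 = 0) (hlt : n < side d) :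
    ∃ h ∈ xSpan d c, ∀ v, axis c v.1 ≤ n → h v = w v := by
  classical
  have hcell : ∀ v : Vertex d, axis c v.1 = n →
      ∃ p, (IsCell d c p ∧ axis c p = n + 1 ∧ v ∈ cellSupport d c p) ∧
        ∀ q, IsCell d c q ∧ axis c q = n + 1 ∧ v ∈ cellSupport d c q → q = p := by
    rintro v rfl
    exact existsUnique_cell_above hn hlt
  choose! above habove hunique using hcell
  let P : Finset Point := ({v | axis c v.1 = n ∧ w v = 1} : Finset (Vertex d)).image above
  have hP : ∀ p ∈ P, IsCell d c p ∧ axis c p = n + 1 := by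
    simp only [P, Finset.mem_image, Finset.mem_filter_univ]
    rintro _ ⟨v, ⟨hv, -⟩, rfl⟩
    exact ⟨(habove v hv).1, (habove v hv).2.1⟩
  refine ⟨∑ p ∈ P, binVec d (cellSupport d c p), sum_mem fun p hp => Submodule.subset_span
    ⟨_, ⟨p, (hP p hp).1, rfl⟩, rfl⟩, fun v hv => ?_⟩
  simp only [Finset.sum_apply, binVec, Set.indicator_apply, Pi.one_apply]
  obtain hv | rfl := hv.lt_or_eq
  · rw [hlow v hv]
    refine Finset.sum_eq_zero fun p hp => if_neg fun hvp => ?_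
    have := axis_le_of_mem_cellSupport (hP p hp).1.1 hvp
    have := (hP p hp).2
    omega
  · have hiff : ∀ p ∈ P, v ∈ cellSupport d c p ↔ p = above v := fun p hp =>
      ⟨fun hvp => hunique v rfl p ⟨(hP p hp).1, (hP p hp).2, hvp⟩,
        fun h => h ▸ (habove v rfl).2.2⟩
    rw [Finset.sum_congr rfl fun p hp => if_congr (hiff p hp) rfl rfl, Finset.sum_ite_eq']
    have hmem : above v ∈ P ↔ w v = 1 := by
      simp only [P, Finset.mem_image, Finset.mem_filter_univ]
      refine ⟨?_, fun hv1 => ⟨v, ⟨rfl, hv1⟩, rfl⟩⟩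
      rintro ⟨u, ⟨hu, hu1⟩, huv⟩
      obtain ⟨hp, hpn, hvp⟩ := habove v rfl
      rw [← hu1]
      exact eq_of_reflTransGen_linked hw hlow (reflTransGen_linked_of_mem_cell hp (by omega)
        (by omega) hvp (huv ▸ (habove u hu).2.2))
    simp only [hmem]
    generalize w v = a
    decide +revert

theorem exists_xSpan_eq_below {c : Colour} {w : Vertex d → ZMod 2} (hw : w ∈ zKernel d c) (n : ℕ)
    (hn : n ≤ side d) : ∃ h ∈ xSpan d c, ∀ v, axis c v.1 < n → h v = w v := by
  induction n with
  | zero => exact ⟨0, zero_mem _, fun v hv => absurd hv (axis_mem_Icc c v).1.not_gt⟩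
  | succ n ih =>
    push_cast at hn ⊢
    obtain ⟨h, hh, hhw⟩ := ih (by omega)
    have hker : w - h ∈ zKernel d c := sub_mem hw (xSpan_le_zKernel c hh)
    have hlow : ∀ u, axis c u.1 < n → (w - h) u = 0 := fun u hu => sub_eq_zero.2 (hhw u hu).symm
    obtain hpar | hpar := Int.emod_two_eq_zero_or_one n
    · obtain ⟨h', hh', hhw'⟩ := exists_xSpan_eq_on_even_layer hker hlow hpar (by omega)
      refine ⟨h + h', add_mem hh hh', fun v hv => ?_⟩
      rw [Pi.add_apply, hhw' v (by omega), Pi.sub_apply, add_sub_cancel]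
    · refine ⟨h, hh, fun v hv => ?_⟩
      obtain hv | hv := (Int.lt_add_one_iff.1 hv).lt_or_eq
      · exact hhw v hv
      · exact (sub_eq_zero.1 (eq_zero_of_odd_height hker (hv ▸ hlow) (hv ▸ hpar))).symm

theorem exists_reflTransGen_linked_corner {c : Colour} {v : Vertex d} (hv : axis c v.1 = side d) :
    ∃ v₀, Relation.ReflTransGen (Linked c) v v₀ ∧ axis c v₀.1 = side d ∧
      ∀ c' ≠ c, axis c' v₀.1 = 0 := by
  induction hm : (sqDist v.1 0).toNat using Nat.strong_induction_on generalizing v with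
  | _ m ih =>
    by_cases hne : ∃ c' ≠ c, axis c' v.1 ≠ 0
    · obtain ⟨v', hlink, hlt⟩ := exists_linked_nearer hv hne
      have hpos : 0 ≤ sqDist v'.1 0 := by
        unfold sqDist
        positivity
      obtain ⟨v₀, h, hv₀⟩ := ih _ (by omega) (hlink.1 ▸ hv) rfl
      exact ⟨v₀, .head hlink h, hv₀⟩
    · push Not at hne
      exact ⟨v, .refl, hv, hne⟩

theorem eq_of_top {c : Colour} {w : Vertex d → ZMod 2} (hw : w ∈ zKernel d c)
    (hlow : ∀ u, axis c u.1 < side d → w u = 0) {v v' : Vertex d} (hv : axis c v.1 = side d)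
    (hv' : axis c v'.1 = side d) : w v = w v' := by
  obtain ⟨u, hvu, hu, hu0⟩ := exists_reflTransGen_linked_corner hv
  obtain ⟨u', hvu', hu', hu0'⟩ := exists_reflTransGen_linked_corner hv'
  have haxis : ∀ c', axis c' u.1 = axis c' u'.1 := fun c' => by
    obtain rfl | hne := eq_or_ne c' c
    exacts [hu.trans hu'.symm, (hu0 c' hne).trans (hu0' c' hne).symm]
  obtain rfl : u = u' := Subtype.ext (Prod.ext (haxis .r) (Prod.ext (haxis .b) (haxis .g)))
  rw [eq_of_reflTransGen_linked hw (hv ▸ hlow) hvu, eq_of_reflTransGen_linked hw (hv' ▸ hlow) hvu']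

theorem eq_smul_binVec_of_constant {S : Set (Vertex d)} {w : Vertex d → ZMod 2}
    (hS : ∀ v ∈ S, ∀ v' ∈ S, w v = w v') (hSc : ∀ v ∉ S, w v = 0) :
    ∃ a : ZMod 2, w = a • binVec d S := by
  obtain rfl | ⟨v₀, hv₀⟩ := S.eq_empty_or_nonempty
  · exact ⟨0, funext fun v => by simp [hSc]⟩
  · refine ⟨w v₀, funext fun v => ?_⟩
    by_cases hv : v ∈ S
    · simp [binVec, hv, hS v hv v₀ hv₀]
    · simp [binVec, hv, hSc v hv]

theorem exists_mem_xCoset_top (hd : 0 < d) {c : Colour} {w : Vertex d → ZMod 2}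
    (hw : w ∈ zKernel d c) : ∃ a, w ∈ xCoset d (fun _ => true) c a := by
  obtain ⟨h, hh, hhw⟩ := exists_xSpan_eq_below hw (side d).toNat (by simp [side]; omega)
  have hker : w - h ∈ zKernel d c := sub_mem hw (xSpan_le_zKernel c hh)
  have hlow : ∀ u, axis c u.1 < side d → (w - h) u = 0 := fun u hu =>
    sub_eq_zero.2 (hhw u (hu.trans_le (Int.self_le_toNat _))).symm
  obtain ⟨a, ha⟩ := eq_smul_binVec_of_constant (S := boundary d c true)
    (fun v hv v' hv' => eq_of_top hker hlow hv hv')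
    fun v hv => hlow v ((axis_mem_Icc c v).2.lt_of_ne hv)
  exact ⟨a, h, hh, eq_add_of_sub_eq ha⟩

theorem binVec_boundary_mem_xCoset (s : Colour → Bool) (c : Colour) :
    binVec d (boundary d c (s c)) ∈ xCoset d s c 1 :=
  ⟨0, zero_mem _, by rw [one_smul, add_zero]⟩

theorem collisionForm_update_boundary (hd : 0 < d) {s : Colour → Bool} {c : Colour} {a : ZMod 2}
    {x : Vertex d → ZMod 2} (hx : x ∈ xCoset d s c a) :
    collisionForm d (Function.update (fun c' => binVec d (boundary d c' (s c'))) c x) = a := by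
  rw [collisionForm_xCoset hd (s := s) (a := Function.update 1 c a) fun c' => ?_]
  · simp [Finset.prod_update_of_mem]
  · obtain rfl | hne := eq_or_ne c' c
    · simpa using hx
    · simpa [hne] using binVec_boundary_mem_xCoset s c'

theorem eq_of_mem_xCoset (hd : 0 < d) {s : Colour → Bool} {c : Colour} {a a' : ZMod 2}
    {x : Vertex d → ZMod 2} (hx : x ∈ xCoset d s c a) (hx' : x ∈ xCoset d s c a') : a = a' :=
  (collisionForm_update_boundary hd hx).symm.trans (collisionForm_update_boundary hd hx')

theorem binVec_boundary_mem_xCoset_top (hd : 0 < d) (c : Colour) (s : Bool) :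
    binVec d (boundary d c s) ∈ xCoset d (fun _ => true) c 1 := by
  obtain ⟨a, ha⟩ := exists_mem_xCoset_top hd (binVec_boundary_mem_zKernel c s)
  have hupdate : Function.update (fun c' => binVec d (boundary d c' true)) c
      (binVec d (boundary d c s)) =
      fun c' => binVec d (boundary d c' (Function.update (fun _ => true) c s c')) := by
    funext c'
    obtain rfl | hne := eq_or_ne c' c <;> simp [*]
  obtain rfl : a = 1 := by
    rw [← collisionForm_update_boundary hd ha, hupdate, collisionForm_boundary hd]
  exact ha

theorem exists_mem_xCoset (hd : 0 < d) (s : Colour → Bool) {c : Colour} {w : Vertex d → ZMod 2}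
    (hw : w ∈ zKernel d c) : ∃ a, w ∈ xCoset d s c a := by
  obtain ⟨a, h, hh, rfl⟩ := exists_mem_xCoset_top hd hw
  obtain ⟨h', hh', hs⟩ := binVec_boundary_mem_xCoset_top hd c (s c)
  refine ⟨a, h - a • h', sub_mem hh (Submodule.smul_mem _ _ hh'), ?_⟩
  rw [hs]
  module

theorem tensorOp_diagonal {ι κ : Type} [Fintype ι] [DecidableEq κ] (D : ι → κ → ℂ) :
    tensorOp (fun i => Matrix.diagonal (D i)) = Matrix.diagonal fun x => ∏ i, D i (x i) := by
  ext x y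
  simp only [tensorOp, Matrix.of_apply, Matrix.diagonal_apply, Fintype.prod_ite_zero, funext_iff]

theorem tensorOp_permMatrix {ι κ : Type} [Fintype ι] [DecidableEq κ] (σ : ι → Equiv.Perm κ) :
    tensorOp (fun i => (σ i).permMatrix ℂ) = Equiv.Perm.permMatrix ℂ (Equiv.piCongrRight σ) := by
  ext x y
  simp [tensorOp, Equiv.Perm.permMatrix, PEquiv.toMatrix_apply, Fintype.prod_ite_zero, funext_iff]

theorem one_div_sqrt_card_ne_zero {κ : Type*} [Finite κ] {S : Set κ} (hS : S.Nonempty) :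
    ((1 / Real.sqrt (Nat.card S) : ℝ) : ℂ) ≠ 0 := by
  have := hS.to_subtype
  have : (0 : ℝ) < Nat.card S := mod_cast Nat.card_pos
  exact mod_cast (by positivity : 1 / Real.sqrt (Nat.card S) ≠ 0)

open Classical in
/-- The normalized uniform superposition of the basis states labelled by the elements of `S`; it is
the zero vector if `S` is empty. -/
noncomputable def uniformState {κ : Type*} [Fintype κ] (S : Set κ) : EuclideanSpace ℂ κ :=
  ((1 / Real.sqrt (Nat.card S) : ℝ) : ℂ) • ∑ x : κ with x ∈ S, EuclideanSpace.single x (1 : ℂ)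

section UniformState

variable {κ : Type*} [Fintype κ]

open Classical in
theorem uniformState_apply (S : Set κ) (x : κ) :
    uniformState S x = if x ∈ S then ((1 / Real.sqrt (Nat.card S) : ℝ) : ℂ) else 0 := by
  simp [uniformState, Finset.sum_apply, WithLp.ofLp_sum]

theorem norm_uniformState {S : Set κ} (hS : S.Nonempty) : ‖uniformState S‖ = 1 := by
  classical
  have := hS.to_subtype
  have hcard : (0 : ℝ) < Nat.card S := mod_cast Nat.card_pos
  rw [← sq_eq_sq₀ (norm_nonneg _) zero_le_one, EuclideanSpace.norm_sq_eq]
  have hterm : ∀ x, ‖uniformState S x‖ ^ 2 = if x ∈ S then 1 / (Nat.card S : ℝ) else 0 := by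
    intro x
    rw [uniformState_apply]
    split_ifs
    · rw [Complex.norm_real, Real.norm_eq_abs, sq_abs, div_pow, Real.sq_sqrt hcard.le, one_pow]
    · simp
  rw [Finset.sum_congr rfl fun x _ => hterm x, ← Finset.sum_filter, Finset.sum_const, nsmul_eq_mul,
    ← Fintype.card_subtype, ← Nat.card_eq_fintype_card, one_pow]
  exact mul_one_div_cancel hcard.ne'

theorem inner_uniformState_of_disjoint {S T : Set κ} (hST : Disjoint S T) :
    inner ℂ (uniformState S) (uniformState T) = 0 := by
  rw [PiLp.inner_apply]
  refine Finset.sum_eq_zero fun x _ => ?_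
  rw [uniformState_apply, uniformState_apply]
  split_ifs with hS hT
  · exact absurd hT (hST.notMem_of_mem_left hS)
  all_goals simp

theorem orthonormal_uniformState {ι : Type*} {S : ι → Set κ} (hne : ∀ i, (S i).Nonempty)
    (hS : Pairwise (Function.onFun Disjoint S)) : Orthonormal ℂ fun i => uniformState (S i) :=
  ⟨fun i => norm_uniformState (hne i), fun _ _ hij => inner_uniformState_of_disjoint (hS hij)⟩

theorem mem_span_range_uniformState {ι : Type*} [Finite ι] {S : ι → Set κ}
    (hS : Pairwise (Function.onFun Disjoint S)) {ψ : EuclideanSpace ℂ κ}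
    (hzero : ∀ x, (∀ i, x ∉ S i) → ψ x = 0) (hconst : ∀ i, ∀ x ∈ S i, ∀ y ∈ S i, ψ x = ψ y) :
    ψ ∈ Submodule.span ℂ (Set.range fun i => uniformState (S i)) := by
  cases nonempty_fintype ι
  have hvalue : ∀ i, ∃ b : ℂ, ∀ x ∈ S i, ψ x = b * uniformState (S i) x := fun i => by
    obtain hi | ⟨x₀, hx₀⟩ := (S i).eq_empty_or_nonempty
    · simp [hi]
    · refine ⟨ψ x₀ / (1 / Real.sqrt (Nat.card (S i)) : ℝ), fun x hx => ?_⟩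
      rw [hconst i x hx x₀ hx₀, uniformState_apply, if_pos hx,
        div_mul_cancel₀ _ (one_div_sqrt_card_ne_zero ⟨x₀, hx₀⟩)]
  choose b hb using hvalue
  suffices hψ : ψ = ∑ i, b i • uniformState (S i) from
    hψ ▸ sum_mem fun i _ => Submodule.smul_mem _ _ (Submodule.subset_span ⟨i, rfl⟩)
  have happly_notMem : ∀ {i x}, x ∉ S i → (b i • uniformState (S i)) x = 0 := fun {i x} hx => by
    rw [PiLp.smul_apply, uniformState_apply, if_neg hx, smul_zero]
  ext x
  rw [WithLp.ofLp_sum, Finset.sum_apply]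
  by_cases hx : ∃ i, x ∈ S i
  · obtain ⟨i, hi⟩ := hx
    rw [Fintype.sum_eq_single i fun j hj =>
      happly_notMem fun hxj => (hS hj).notMem_of_mem_left hxj hi]
    exact hb i x hi
  · push Not at hx
    rw [hzero x hx, Finset.sum_eq_zero fun i _ => happly_notMem (hx i)]

theorem toEuclideanLin_diagonal_uniformState [DecidableEq κ] {D : κ → ℂ} {S : Set κ} {b : ℂ}
    (hD : ∀ x ∈ S, D x = b) :
    Matrix.toEuclideanLin (Matrix.diagonal D) (uniformState S) = b • uniformState S := by
  ext x
  rw [Matrix.ofLp_toLpLin, Matrix.toLin'_apply, Matrix.mulVec_diagonal, PiLp.smul_apply,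
    uniformState_apply, smul_eq_mul]
  split_ifs with hx
  · rw [hD x hx]
  · rw [mul_zero, mul_zero]

end UniformState

/-- The configuration equal to `h` on the qubits of the code `c` and to zero on all others: adding
it is the action on basis states of a product of operators `X` on the code `c`. -/
def onLayer (c : Colour) : (Vertex d → ZMod 2) →ₗ[ZMod 2] Config d :=
  (LinearMap.single (ZMod 2) (fun _ => ZMod 2) c).compLeft (Vertex d)

theorem onLayer_apply (c : Colour) (h : Vertex d → ZMod 2) (v : Vertex d) :
    onLayer c h v = Pi.single c (h v) :=
  rfl

theorem sum_onLayer (x : Config d) : ∑ c, onLayer c (fun v => x v c) = x := by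
  funext v
  rw [Finset.sum_apply]
  exact Finset.univ_sum_single (x v)

theorem addChar_map_sum {A M ι : Type*} [AddCommMonoid A] [CommMonoid M] (χ : AddChar A M)
    (f : ι → A) (T : Finset ι) : χ (∑ i ∈ T, f i) = ∏ i ∈ T, χ (f i) :=
  map_prod χ.toMonoidHom (fun i => Multiplicative.ofAdd (f i)) T

/-- The nontrivial character of `ZMod 2`, whose values are the eigenvalues of the Pauli matrix
`Z`. -/
noncomputable def parityChar : AddChar (ZMod 2) ℂ :=
  AddChar.zmodChar 2 (ζ := -1) (by norm_num)

theorem parityChar_eq_ite (a : ZMod 2) : parityChar a = if a = 0 then 1 else -1 := by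
  obtain rfl | rfl := (by decide : ∀ a : ZMod 2, a = 0 ∨ a = 1) a
  · simp
  · simp [parityChar, AddChar.zmodChar_apply, ZMod.val_one]

theorem parityChar_eq_one_iff {a : ZMod 2} : parityChar a = 1 ↔ a = 0 := by
  rw [parityChar_eq_ite]
  split_ifs with ha <;> norm_num [ha]

theorem ite_pauliX (P : Prop) [Decidable P] :
    (if P then pauliX else 1) =
      (Equiv.addRight (if P then 1 else 0 : ZMod 2)).permMatrix ℂ := by
  ext i j
  have hij : i + 1 = j ↔ i ≠ j := by revert i j; decide
  split_ifs <;>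
    simp [pauliX, Matrix.one_apply, Equiv.Perm.permMatrix, PEquiv.toMatrix_apply, hij]

theorem ite_pauliZ (P : Prop) [Decidable P] :
    (if P then pauliZ else 1) =
      Matrix.diagonal fun a => parityChar ((if P then 1 else 0) * a) := by
  split_ifs
  · simp [pauliZ, parityChar_eq_ite]
  · simp

theorem applyOn_pauliX_apply (c : Colour) (S : Set (Vertex d)) (ψ : StackSpace d) (x : Config d) :
    applyOn d pauliX c S ψ x = ψ (x + onLayer c (binVec d S)) := by
  classical
  simp only [applyOn, ite_pauliX, tensorOp_permMatrix, Matrix.ofLp_toLpLin, Matrix.toLin'_apply,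
    Matrix.permMatrix_mulVec, Function.comp_apply]
  refine congrArg ψ (funext₂ fun v c' => ?_)
  by_cases hc : c' = c <;> simp [onLayer_apply, binVec, Set.indicator_apply, hc]

theorem applyOn_pauliZ_apply (c : Colour) (S : Set (Vertex d)) (ψ : StackSpace d) (x : Config d) :
    applyOn d pauliZ c S ψ x = parityChar (binVec d S ⬝ᵥ fun v => x v c) * ψ x := by
  classical
  simp only [applyOn, ite_pauliZ, tensorOp_diagonal, Matrix.ofLp_toLpLin, Matrix.toLin'_apply,
    Matrix.mulVec_diagonal, dotProduct, addChar_map_sum]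
  congr 1
  refine Finset.prod_congr rfl fun v _ => ?_
  rw [Fintype.prod_eq_single c fun c' hc => by simp [hc]]
  simp [binVec, Set.indicator_apply]

theorem mem_codeSpace {ψ : StackSpace d} : ψ ∈ codeSpace d ↔ ∀ c,
    (∀ S ∈ xSupports d c, Function.Periodic ψ (onLayer c (binVec d S))) ∧
      ∀ x : Config d, (fun v => x v c) ∉ zKernel d c → ψ x = 0 := by
  simp only [codeSpace, Submodule.mem_iInf, Submodule.mem_inf, Module.End.mem_eigenspace_iff,
    one_smul, PiLp.ext_iff, applyOn_pauliX_apply, applyOn_pauliZ_apply]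
  refine forall_congr' fun c => and_congr Iff.rfl ⟨fun h x hx => ?_, fun h S hS x => ?_⟩
  · rw [mem_zKernel] at hx
    push Not at hx
    obtain ⟨S, hS, hne⟩ := hx
    by_contra hψ
    exact hne (parityChar_eq_one_iff.1 ((mul_eq_right₀ hψ).1 (h S hS x)))
  · by_cases hx : (fun v => x v c) ∈ zKernel d c
    · rw [mem_zKernel.1 hx S hS, AddChar.map_zero_eq_one, one_mul]
    · rw [h x hx, mul_zero]

theorem periodic_onLayer_of_mem_codeSpace {ψ : StackSpace d} (hψ : ψ ∈ codeSpace d) {c : Colour}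
    {h : Vertex d → ZMod 2} (hh : h ∈ xSpan d c) : Function.Periodic ψ (onLayer c h) := by
  induction hh using Submodule.span_induction with
  | mem _ hS =>
    obtain ⟨S, hS, rfl⟩ := hS
    exact (mem_codeSpace.1 hψ c).1 S hS
  | zero => simp [Function.Periodic]
  | add _ _ _ _ ih ih' => rw [map_add]; exact ih.add_period ih'
  | smul a h _ ih =>
    rw [map_smul]
    obtain rfl | rfl := (by decide : ∀ a : ZMod 2, a = 0 ∨ a = 1) a
    · simp [Function.Periodic]
    · rwa [one_smul]

theorem periodic_of_mem_codeSpace {ψ : StackSpace d} (hψ : ψ ∈ codeSpace d) {x : Config d}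
    (hx : ∀ c, (fun v => x v c) ∈ xSpan d c) : Function.Periodic ψ x := by
  rw [← sum_onLayer x]
  exact Finset.sum_induction _ (Function.Periodic ψ) (fun _ _ => Function.Periodic.add_period)
    (by simp [Function.Periodic]) fun c _ => periodic_onLayer_of_mem_codeSpace hψ (hx c)

theorem sub_mem_xSpan {s : Colour → Bool} {c : Colour} {a : ZMod 2} {x y : Vertex d → ZMod 2}
    (hx : x ∈ xCoset d s c a) (hy : y ∈ xCoset d s c a) : x - y ∈ xSpan d c := by
  obtain ⟨h, hh, rfl⟩ := hx
  obtain ⟨k, hk, rfl⟩ := hy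
  rw [add_sub_add_left_eq_sub]
  exact sub_mem hh hk

theorem add_mem_xCoset_iff {s : Colour → Bool} {c : Colour} {a : ZMod 2} {x h : Vertex d → ZMod 2}
    (hh : h ∈ xSpan d c) : x + h ∈ xCoset d s c a ↔ x ∈ xCoset d s c a := by
  constructor
  · rintro ⟨k, hk, hx⟩
    exact ⟨k - h, sub_mem hk hh, by rw [← add_sub_assoc, ← hx, add_sub_cancel_right]⟩
  · rintro ⟨k, hk, rfl⟩
    exact ⟨k + h, add_mem hk hh, add_assoc ..⟩

/-- The configurations that occur in the encoded state `stackKet d s a`: their restriction to the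
qubits of each code `c` lies in the coset labelled by `a c`. -/
def codewords (d : ℕ) (s : Colour → Bool) (a : Colour → ZMod 2) : Set (Config d) :=
  {x | ∀ c, (fun v => x v c) ∈ xCoset d s c (a c)}

theorem codewords_nonempty (s : Colour → Bool) (a : Colour → ZMod 2) :
    (codewords d s a).Nonempty :=
  ⟨fun v c => a c * binVec d (boundary d c (s c)) v, fun _ => ⟨0, zero_mem _, (add_zero _).symm⟩⟩

theorem pairwise_disjoint_codewords (hd : 0 < d) (s : Colour → Bool) :
    Pairwise (Function.onFun Disjoint (codewords d s)) := fun _ _ hab =>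
  Set.disjoint_left.2 fun _ hx hx' => hab (funext fun c => eq_of_mem_xCoset hd (hx c) (hx' c))

theorem exists_mem_codewords (hd : 0 < d) (s : Colour → Bool) {x : Config d}
    (hx : ∀ c, (fun v => x v c) ∈ zKernel d c) : ∃ a, x ∈ codewords d s a :=
  Classical.skolem.1 fun c => exists_mem_xCoset hd s (hx c)

theorem add_onLayer_mem_codewords_iff {s : Colour → Bool} {a : Colour → ZMod 2} {c : Colour}
    {h : Vertex d → ZMod 2} (hh : h ∈ xSpan d c) {x : Config d} :
    x + onLayer c h ∈ codewords d s a ↔ x ∈ codewords d s a := by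
  refine forall_congr' fun c' => ?_
  have hlayer : (fun v => (x + onLayer c h) v c') =
      (fun v => x v c') + Pi.single (M := fun _ => Vertex d → ZMod 2) c h c' := by
    funext v
    obtain rfl | hne := eq_or_ne c' c <;> simp [onLayer_apply, *]
  rw [hlayer]
  refine add_mem_xCoset_iff ?_
  obtain rfl | hne := eq_or_ne c' c <;> simp [*]

theorem card_codewords (s : Colour → Bool) (a : Colour → ZMod 2) :
    Nat.card (codewords d s a) = ∏ c, Nat.card (xCoset d s c (a c)) := by
  rw [← Nat.card_pi]
  exact Nat.card_congr <|
    ((Equiv.piComm fun _ _ => ZMod 2).subtypeEquiv fun _ => Iff.rfl).trans Equiv.subtypePiEquivPi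

theorem encodedKet_eq_uniformState (s : Colour → Bool) (c : Colour) (a : ZMod 2) :
    encodedKet d s c a = uniformState (xCoset d s c a) := by
  ext x
  simp [encodedKet, uniformState]

theorem stackKet_eq_uniformState (s : Colour → Bool) (a : Colour → ZMod 2) :
    stackKet d s a = uniformState (codewords d s a) := by
  classical
  ext x
  simp only [stackKet, encodedKet_eq_uniformState, uniformState_apply, Fintype.prod_ite_zero]
  congr 1
  rw [card_codewords, ← Complex.ofReal_prod, Finset.prod_div_distrib, Finset.prod_const_one,
    Nat.cast_prod, Real.sqrt_prod _ fun c _ => Nat.cast_nonneg _]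

theorem orthonormal_stackKet (hd : 0 < d) (s : Colour → Bool) : Orthonormal ℂ (stackKet d s) := by
  simp only [funext (stackKet_eq_uniformState s)]
  exact orthonormal_uniformState (codewords_nonempty s) (pairwise_disjoint_codewords hd s)

theorem stackKet_mem_codeSpace (s : Colour → Bool) (a : Colour → ZMod 2) :
    stackKet d s a ∈ codeSpace d := by
  classical
  rw [stackKet_eq_uniformState]
  refine mem_codeSpace.2 fun c => ⟨fun S hS x => ?_, fun x hx => ?_⟩
  · have hmem : binVec d S ∈ xSpan d c := Submodule.subset_span ⟨S, hS, rfl⟩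
    rw [uniformState_apply, uniformState_apply]
    exact if_congr (add_onLayer_mem_codewords_iff hmem) rfl rfl
  · rw [uniformState_apply]
    exact if_neg fun h => hx (xCoset_subset_zKernel s c (a c) (h c))

theorem span_stackKet (hd : 0 < d) (s : Colour → Bool) :
    Submodule.span ℂ (Set.range (stackKet d s)) = codeSpace d := by
  refine le_antisymm (Submodule.span_le.2 ?_) fun ψ hψ => ?_
  · rintro _ ⟨a, rfl⟩
    exact stackKet_mem_codeSpace s a
  simp only [funext (stackKet_eq_uniformState s)]
  refine mem_span_range_uniformState (pairwise_disjoint_codewords hd s) (fun x hx => ?_)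
    fun a x hx y hy => ?_
  · by_contra hψx
    obtain ⟨a, ha⟩ := exists_mem_codewords hd s fun c =>
      not_not.1 fun hc => hψx ((mem_codeSpace.1 hψ c).2 x hc)
    exact hx a ha
  · have := periodic_of_mem_codeSpace hψ (x := x - y) (fun c => sub_mem_xSpan (hx c) (hy c)) y
    rwa [add_sub_cancel] at this

theorem transversalCCZ_eq_diagonal : transversalCCZ d =
    Matrix.toEuclideanLin (Matrix.diagonal fun x => (-1) ^ collisions d fun c v => x v c) := by
  rw [transversalCCZ]
  simp only [ccz, tensorOp_diagonal, Finset.prod_ite, Finset.prod_const, one_pow, mul_one,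
    collisions]

theorem transversalCCZ_stackKet (hd : 0 < d) (s : Colour → Bool) (a : Colour → ZMod 2) :
    transversalCCZ d (stackKet d s a) =
      (if ∀ c, a c = 1 then (-1 : ℂ) else 1) • stackKet d s a := by
  rw [transversalCCZ_eq_diagonal, stackKet_eq_uniformState]
  refine toEuclideanLin_diagonal_uniformState fun x hx => ?_
  have hodd := odd_collisions_iff hd (x := fun c v => x v c) hx
  split_ifs with ha
  · exact (hodd.2 ha).neg_one_pow
  · exact (Nat.not_odd_iff_even.1 (mt hodd.1 ha)).neg_one_pow

end CCZStack

theorem mainTheorem1 (d : ℕ) (hd : 2 ≤ d) (s : CCZStack.Colour → Bool) :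
    -- the eight encoded states are an orthonormal basis of the code space of the stack
    Orthonormal ℂ (CCZStack.stackKet d s) ∧
    Submodule.span ℂ (Set.range (CCZStack.stackKet d s)) = CCZStack.codeSpace d ∧
    -- the transversal gate acts on this basis as the logical `CCZ`
    (∀ a : CCZStack.Colour → ZMod 2,
      CCZStack.transversalCCZ d (CCZStack.stackKet d s a) =
        (if ∀ c, a c = 1 then (-1 : ℂ) else 1) • CCZStack.stackKet d s a) ∧
    -- the number of collisions of three codewords is odd exactly for the logical state `111`
    (∀ (a : CCZStack.Colour → ZMod 2) (x : CCZStack.Colour → CCZStack.Vertex d → ZMod 2),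
      (∀ c, x c ∈ CCZStack.xCoset d s c (a c)) →
        (Odd (CCZStack.collisions d x) ↔ ∀ c, a c = 1)) := by
  have hd' : 0 < d := by omega
  exact ⟨CCZStack.orthonormal_stackKet hd' s, CCZStack.span_stackKet hd' s,
    CCZStack.transversalCCZ_stackKet hd' s, fun _ _ hx => CCZStack.odd_collisions_iff hd' hx⟩
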